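/- **Proposition 3.3.** Let $q$ be a nonzero complex number with $|q|\neq 1$; fix a logarithm $\ell$ of $q$ and put $q^a=e^{a\ell}$ and $[a]_q=\frac{q^a-q^{-a}}{q-q^{-1}}$. Let $n\in\mathbb N$, $\mu_1,\dots,\mu_n>0$, $\gamma_i=\mu_i+\tfrac12$, and $[n]=\{1,\dots,n\}$. *The algebra.* Let $U=\mathfrak{osp}_q(1|2)$ be the unital associative $\mathbb C$-algebra with generators $A_+,A_-,K,K^{-1},P$ and relations $$KA_\pm K^{-1}=q^{\pm1/2}A_\pm,\quad A_+A_-+A_-A_+=\tfrac{K^2-K^{-2}}{q^{1/2}-q^{-1/2}},\quad PA_\pm+A_\pm P=0,\quad PK^{\pm1}=K^{\pm1}P,\quad KK^{-1}=K^{-1}K=1,\quad P^2=1,$$ with Casimir element $\Gamma^q=\Big(-A_+A_-+\frac{q^{-1/2}K^2-q^{1/2}K^{-2}}{q-q^{-1}}\Big)P$ and coproduct the algebra morphism $\Delta:U\to U\otimes U$ (ungraded tensor product) given by $$\Delta(A_\pm)=A_\pm\otimes KP+K^{-1}\otimes A_\pm,\qquad \Delta(K^{\pm1})=K^{\pm1}\otimes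 K^{\pm1},\qquad \Delta(P)=P\otimes P.$$ Let $\mathcal I\subset U$ be the subalgebra generated by $A_-K,\ A_+K,\ K^2P,\ \Gamma^q$; it satisfies $\Delta(\mathcal I)\subset U\otimes\mathcal I$. Let $\tau:\mathcal I\to U\otimes\mathcal I$ be the algebra morphism with $$\begin{aligned}\tau(A_-K)&=K^2P\otimes A_-K,\qquad \tau(\Gamma^q)=1\otimes\Gamma^q,\\ \tau(K^2P)&=1\otimes K^2P-(q-q^{-1})\,A_+K\otimes A_-K,\\ \tau(A_+K)&=K^{-2}P\otimes A_+K+q^{-1/2}(q-q^{-1})A_+^2P\otimes A_-K+q^{-1/2}(q^{1/2}-q^{-1/2})A_+K^{-1}P\otimes K^2P+q^{-1/2}(q-q^{-1})A_+K^{-1}P\otimes\Gamma^q.\end{aligned}$$ *The elements $\Gamma_A^q\in U^{\otimes n}$, $A\subseteq[n]$.* Put $\Gamma_\emptyset^q=-[\tfrac12]_q$. For $A\ne\emptyset$ start with $1^{\otimes(\min A-1)}\otimes\Gamma^q$ and, for $k=\min A+1,\dots,\max A$ in increasing order, do the following: if $k-1,k\in A$, apply $\Delta$ to the last tensor factor;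 if $k-1\in A$, $k\notin A$, apply $\Delta$ to the last factor and then $\tau$ to the new last factor; if $k-1,k\notin A$, apply $\Delta$ to the last factor but one; if $k-1\notin A$, $k\in A$, do nothing. Finally append $n-\max A$ factors $1$. The result is $\Gamma_A^q$. The $q$-Bannai–Ito algebra $\mathcal A_n^q$ is the subalgebra of $U^{\otimes n}$ generated by all $\Gamma_A^q$, $A\subseteq[n]$. *The model.* On $\mathbb C[x_1,\dots,x_n]$ let $T_{q,i}^{a}$ be the operator $x_i\mapsto q^{a}x_i$ (for $a=\pm1,\pm\tfrac12$), let $r_i$ be the reflection $x_i\mapsto -x_i$, and put $$D_i^q=\frac{q^{\mu_i}}{q-q^{-1}}\,\frac{T_{q,i}-r_i}{x_i}-\frac{q^{-\mu_i}}{q-q^{-1}}\,\frac{T_{q,i}^{-1}-r_i}{x_i},\qquad R_{[n],i}^q=\Big(\prod_{j<i}q^{-\gamma_j/2}T_{q,j}^{-1/2}\Big)\Big(\prod_{j>i}q^{\gamma_j/2}T_{q,j}^{1/2}r_j\Big),$$ $$D_{[n]}^q=\sum_{i=1}^nD_i^qR_{[n],i}^q,\qquad X_{[n]}^q=\sum_{i=1}^nx_iR_{[n],i}^q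 .$$ Let $\rho$ be the algebra morphism from $U^{\otimes n}$ to the operators on $\mathbb C[x_1,\dots,x_n]$ under which the $i$-th tensor factor acts on the variable $x_i$ by $A_+\mapsto x_i$, $A_-\mapsto D_i^q$, $K^{\pm1}\mapsto q^{\pm\gamma_i/2}T_{q,i}^{\pm1/2}$, $P\mapsto r_i$. *Claim.* For every $A\subseteq[n]$, $$[D_{[n]}^q,\rho(\Gamma_A^q)]=0,\qquad [X_{[n]}^q,\rho(\Gamma_A^q)]=0 .$$ Consequently $\rho(a)$ commutes with $D_{[n]}^q$ and with $X_{[n]}^q$ for every $a\in\mathcal A_n^q$; that is, $\mathcal A_n^q$ acts as an algebra of symmetries of the model. -/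

import Mathlib

open scoped TensorProduct

set_option linter.unusedSimpArgs false

noncomputable section

namespace QDunkl

/-- A nonzero complex number `q` with `|q| ≠ 1`, together with a choice of logarithm of `q`,
which fixes the meaning of all powers `q ^ a`. -/
structure QDeformation where
  q : ℂ
  logq : ℂ
  exp_logq : Complex.exp logq = q
  norm_q_ne_one : ‖q‖ ≠ 1

namespace QDeformation

variable (Q : QDeformation)

/-- The power `q ^ a`, with respect to the chosen logarithm of `q`. -/
def pow (a : ℂ) : ℂ := Complex.exp (a * Q.logq)

/-- The `q`-number `[a]_q = (q ^ a - q ^ (-a)) / (q - q⁻¹)`. -/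
def num (a : ℂ) : ℂ := (Q.pow a - Q.pow (-a)) / (Q.q - Q.q⁻¹)

theorem pow_ne_zero (a : ℂ) : Q.pow a ≠ 0 := Complex.exp_ne_zero _

theorem pow_add (a b : ℂ) : Q.pow (a + b) = Q.pow a * Q.pow b := by
  rw [pow, pow, pow, add_mul, Complex.exp_add]

theorem pow_neg (a : ℂ) : Q.pow (-a) = (Q.pow a)⁻¹ := by
  rw [pow, pow, neg_mul, Complex.exp_neg]

theorem pow_one : Q.pow 1 = Q.q := by rw [pow, one_mul, Q.exp_logq]

theorem pow_nat_mul (k : ℕ) (a : ℂ) : Q.pow (k * a) = Q.pow a ^ k := by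
  rw [pow, pow, mul_assoc, Complex.exp_nat_mul]

/-- The square root `q ^ (1/2)`. -/
def s : ℂ := Q.pow (1 / 2)

theorem pow_half : Q.pow (1 / 2) = Q.s := rfl

theorem s_ne_zero : Q.s ≠ 0 := Q.pow_ne_zero _

theorem pow_neg_half : Q.pow (-1 / 2) = (Q.s)⁻¹ := by
  rw [neg_div, pow_neg, pow_half]

theorem q_eq : Q.q = Q.s ^ 2 := by
  rw [← Q.pow_one, s, ← pow_nat_mul]; norm_num

theorem q_ne_zero : Q.q ≠ 0 := by rw [q_eq]; exact _root_.pow_ne_zero _ Q.s_ne_zero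

theorem norm_s_ne_one : ‖Q.s‖ ≠ 1 := by
  intro h
  apply Q.norm_q_ne_one
  rw [q_eq, norm_pow, h, one_pow]

theorem s_pow_ne_one (k : ℕ) (hk : k ≠ 0) : Q.s ^ k ≠ 1 := by
  intro h
  have h1 : ‖Q.s‖ ^ k = 1 := by rw [← norm_pow, h, norm_one]
  exact Q.norm_s_ne_one ((pow_eq_one_iff_of_nonneg (norm_nonneg _) hk).1 h1)

theorem s_four : Q.s ^ 4 - 1 ≠ 0 := sub_ne_zero.2 (Q.s_pow_ne_one 4 (by norm_num))
theorem s_two : Q.s ^ 2 - 1 ≠ 0 := sub_ne_zero.2 (Q.s_pow_ne_one 2 (by norm_num))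

end QDeformation

variable (Q : QDeformation)

/-- Names of the generators `A₊, A₋, K, K⁻¹, P`. -/
inductive OspGen
  | ap | am | k | ki | p

open OspGen in
/-- The defining relations of `osp_q(1|2)` between the generators `A₊, A₋, K, K⁻¹, P`. -/
inductive OspRel : FreeAlgebra ℂ OspGen → FreeAlgebra ℂ OspGen → Prop
  | k_ap : OspRel (FreeAlgebra.ι ℂ k * FreeAlgebra.ι ℂ ap * FreeAlgebra.ι ℂ ki)
      (Q.pow (1 / 2) • FreeAlgebra.ι ℂ ap)
  | k_am : OspRel (FreeAlgebra.ι ℂ k * FreeAlgebra.ι ℂ am * FreeAlgebra.ι ℂ ki)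
      (Q.pow (-1 / 2) • FreeAlgebra.ι ℂ am)
  | ap_am : OspRel
      (FreeAlgebra.ι ℂ ap * FreeAlgebra.ι ℂ am + FreeAlgebra.ι ℂ am * FreeAlgebra.ι ℂ ap)
      ((Q.pow (1 / 2) - Q.pow (-1 / 2))⁻¹ • (FreeAlgebra.ι ℂ k ^ 2 - FreeAlgebra.ι ℂ ki ^ 2))
  | p_ap : OspRel
      (FreeAlgebra.ι ℂ p * FreeAlgebra.ι ℂ ap + FreeAlgebra.ι ℂ ap * FreeAlgebra.ι ℂ p) 0
  | p_am : OspRel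
      (FreeAlgebra.ι ℂ p * FreeAlgebra.ι ℂ am + FreeAlgebra.ι ℂ am * FreeAlgebra.ι ℂ p) 0
  | p_k : OspRel (FreeAlgebra.ι ℂ p * FreeAlgebra.ι ℂ k) (FreeAlgebra.ι ℂ k * FreeAlgebra.ι ℂ p)
  | p_ki : OspRel (FreeAlgebra.ι ℂ p * FreeAlgebra.ι ℂ ki)
      (FreeAlgebra.ι ℂ ki * FreeAlgebra.ι ℂ p)
  | k_ki : OspRel (FreeAlgebra.ι ℂ k * FreeAlgebra.ι ℂ ki) 1
  | ki_k : OspRel (FreeAlgebra.ι ℂ ki * FreeAlgebra.ι ℂ k) 1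
  | p_p : OspRel (FreeAlgebra.ι ℂ p ^ 2) 1

/-- The quantum superalgebra `osp_q(1|2)`, extended by its grade involution. -/
def Osp : Type := RingQuot (OspRel Q)

instance : Ring (Osp Q) := inferInstanceAs (Ring (RingQuot (OspRel Q)))
instance : Algebra ℂ (Osp Q) := inferInstanceAs (Algebra ℂ (RingQuot (OspRel Q)))

/-- The relations of `osp_q(1|2)`, for a family of elements of an algebra. -/
structure IsOsp {R : Type*} [Ring R] [Algebra ℂ R] (x : OspGen → R) : Prop where
  k_ap : x .k * x .ap * x .ki = Q.pow (1 / 2) • x .ap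
  k_am : x .k * x .am * x .ki = Q.pow (-1 / 2) • x .am
  ap_am : x .ap * x .am + x .am * x .ap
    = (Q.pow (1 / 2) - Q.pow (-1 / 2))⁻¹ • (x .k ^ 2 - x .ki ^ 2)
  p_ap : x .p * x .ap + x .ap * x .p = 0
  p_am : x .p * x .am + x .am * x .p = 0
  p_k : x .p * x .k = x .k * x .p
  p_ki : x .p * x .ki = x .ki * x .p
  k_ki : x .k * x .ki = 1
  ki_k : x .ki * x .k = 1
  p_p : x .p ^ 2 = 1

namespace Osp

/-- The generators of `osp_q(1|2)`. -/
def gen (i : OspGen) : Osp Q := RingQuot.mkAlgHom ℂ (OspRel Q) (FreeAlgebra.ι ℂ i)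

theorem isOsp_gen : IsOsp Q (gen Q) := by
  constructor
  · have h := RingQuot.mkAlgHom_rel ℂ (OspRel.k_ap (Q := Q))
    simp only [map_mul, map_smul, map_add, map_sub, map_pow, map_one, map_zero] at h
    exact h
  · have h := RingQuot.mkAlgHom_rel ℂ (OspRel.k_am (Q := Q))
    simp only [map_mul, map_smul, map_add, map_sub, map_pow, map_one, map_zero] at h
    exact h
  · have h := RingQuot.mkAlgHom_rel ℂ (OspRel.ap_am (Q := Q))
    simp only [map_mul, map_smul, map_add, map_sub, map_pow, map_one, map_zero] at h
    exact h
  · have h := RingQuot.mkAlgHom_rel ℂ (OspRel.p_ap (Q := Q))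
    simp only [map_mul, map_smul, map_add, map_sub, map_pow, map_one, map_zero] at h
    exact h
  · have h := RingQuot.mkAlgHom_rel ℂ (OspRel.p_am (Q := Q))
    simp only [map_mul, map_smul, map_add, map_sub, map_pow, map_one, map_zero] at h
    exact h
  · have h := RingQuot.mkAlgHom_rel ℂ (OspRel.p_k (Q := Q))
    simp only [map_mul, map_smul, map_add, map_sub, map_pow, map_one, map_zero] at h
    exact h
  · have h := RingQuot.mkAlgHom_rel ℂ (OspRel.p_ki (Q := Q))
    simp only [map_mul, map_smul, map_add, map_sub, map_pow, map_one, map_zero] at h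
    exact h
  · have h := RingQuot.mkAlgHom_rel ℂ (OspRel.k_ki (Q := Q))
    simp only [map_mul, map_smul, map_add, map_sub, map_pow, map_one, map_zero] at h
    exact h
  · have h := RingQuot.mkAlgHom_rel ℂ (OspRel.ki_k (Q := Q))
    simp only [map_mul, map_smul, map_add, map_sub, map_pow, map_one, map_zero] at h
    exact h
  · have h := RingQuot.mkAlgHom_rel ℂ (OspRel.p_p (Q := Q))
    simp only [map_mul, map_smul, map_add, map_sub, map_pow, map_one, map_zero] at h
    exact h

variable {Q}

/-- The universal property of `osp_q(1|2)`. -/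
def lift {R : Type*} [Ring R] [Algebra ℂ R] (x : OspGen → R) (hx : IsOsp Q x) : Osp Q →ₐ[ℂ] R :=
  RingQuot.liftAlgHom ℂ ⟨FreeAlgebra.lift ℂ x, by
    intro u v h
    cases h
    · simpa using hx.k_ap
    · simpa using hx.k_am
    · simpa using hx.ap_am
    · simpa using hx.p_ap
    · simpa using hx.p_am
    · simpa using hx.p_k
    · simpa using hx.p_ki
    · simpa using hx.k_ki
    · simpa using hx.ki_k
    · simpa using hx.p_p⟩

theorem lift_gen {R : Type*} [Ring R] [Algebra ℂ R] (x : OspGen → R) (hx : IsOsp Q x)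
    (i : OspGen) : lift x hx (gen Q i) = x i := by
  simp only [lift, gen]
  erw [RingQuot.liftAlgHom_mkAlgHom_apply]
  simp

theorem hom_ext {R : Type*} [Ring R] [Algebra ℂ R] {f g : Osp Q →ₐ[ℂ] R}
    (h : ∀ i, f (gen Q i) = g (gen Q i)) : f = g := by
  apply RingQuot.ringQuot_ext'
  ext i
  exact h i

end Osp

section Relations

variable {Q} {R : Type*} [Ring R] [Algebra ℂ R] {x : OspGen → R}

theorem IsOsp.nf (h : IsOsp Q x) :
    x .k * x .ap = Q.s • (x .ap * x .k) ∧ x .k * x .am = (Q.s)⁻¹ • (x .am * x .k) ∧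
    x .ki * x .ap = (Q.s)⁻¹ • (x .ap * x .ki) ∧ x .ki * x .am = Q.s • (x .am * x .ki) ∧
    x .p * x .ap = (-1 : ℂ) • (x .ap * x .p) ∧ x .p * x .am = (-1 : ℂ) • (x .am * x .p) ∧
    x .p * x .k = x .k * x .p ∧ x .p * x .ki = x .ki * x .p ∧
    x .k * x .ki = 1 ∧ x .ki * x .k = 1 ∧ x .p * x .p = 1 ∧
    x .am * x .ap = (-1 : ℂ) • (x .ap * x .am)
      + (Q.s - (Q.s)⁻¹)⁻¹ • (x .k * x .k) - (Q.s - (Q.s)⁻¹)⁻¹ • (x .ki * x .ki) := by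
  have hs := Q.s_ne_zero
  have e1 : x .k * x .ap = Q.s • (x .ap * x .k) := by
    have := congrArg (· * x .k) h.k_ap
    simpa only [mul_assoc, h.ki_k, mul_one, smul_mul_assoc, Q.pow_half] using this
  have e2 : x .k * x .am = (Q.s)⁻¹ • (x .am * x .k) := by
    have := congrArg (· * x .k) h.k_am
    simpa only [mul_assoc, h.ki_k, mul_one, smul_mul_assoc, Q.pow_neg_half] using this
  have e3 : x .ki * x .ap = (Q.s)⁻¹ • (x .ap * x .ki) := by
    have := congrArg (fun y => (Q.s)⁻¹ • (x .ki * y * x .ki)) e1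
    simp only [mul_assoc, h.k_ki, mul_smul_comm, smul_mul_assoc, smul_smul,
      inv_mul_cancel₀ hs, one_smul, mul_one] at this
    rw [← this, ← mul_assoc, h.ki_k, one_mul]
  have e4 : x .ki * x .am = Q.s • (x .am * x .ki) := by
    have := congrArg (fun y => (Q.s) • (x .ki * y * x .ki)) e2
    simp only [mul_assoc, h.k_ki, mul_smul_comm, smul_mul_assoc, smul_smul,
      mul_inv_cancel₀ hs, one_smul, mul_one] at this
    rw [← this, ← mul_assoc, h.ki_k, one_mul]
  refine ⟨e1, e2, e3, e4, ?_, ?_, h.p_k, h.p_ki, h.k_ki, h.ki_k, ?_, ?_⟩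
  · rw [neg_one_smul]; exact eq_neg_of_add_eq_zero_left h.p_ap
  · rw [neg_one_smul]; exact eq_neg_of_add_eq_zero_left h.p_am
  · rw [← sq, h.p_p]
  · have := h.ap_am
    rw [Q.pow_neg_half, Q.pow_half, smul_sub, sq, sq] at this
    rw [eq_sub_of_add_eq' this]
    module

end Relations

namespace Osp

variable {Q}

/-- Extend a rewriting rule for a product to products with a further factor. -/
theorem assoc_rule {R : Type*} [Ring R] {a b c : R} (h : a * b = c) (z : R) :
    a * (b * z) = c * z := by rw [← mul_assoc, h]

end Osp

/-- The generator `A₊`. -/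
abbrev Osp.ap : Osp Q := Osp.gen Q .ap
/-- The generator `A₋`. -/
abbrev Osp.am : Osp Q := Osp.gen Q .am
/-- The generator `K`. -/
abbrev Osp.k : Osp Q := Osp.gen Q .k
/-- The generator `K⁻¹`. -/
abbrev Osp.ki : Osp Q := Osp.gen Q .ki
/-- The generator `P`. -/
abbrev Osp.p : Osp Q := Osp.gen Q .p

/-- The Casimir element `Γ^q` of `osp_q(1|2)`. -/
def Osp.casimir : Osp Q :=
  (-(Osp.ap Q * Osp.am Q) + (Q.q - Q.q⁻¹)⁻¹ •
    (Q.pow (-1 / 2) • Osp.k Q ^ 2 - Q.pow (1 / 2) • Osp.ki Q ^ 2)) * Osp.p Q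

/-- The values of the coproduct on the generators. -/
def Osp.comulGen : OspGen → Osp Q ⊗[ℂ] Osp Q
  | .ap => Osp.ap Q ⊗ₜ (Osp.k Q * Osp.p Q) + Osp.ki Q ⊗ₜ Osp.ap Q
  | .am => Osp.am Q ⊗ₜ (Osp.k Q * Osp.p Q) + Osp.ki Q ⊗ₜ Osp.am Q
  | .k => Osp.k Q ⊗ₜ Osp.k Q
  | .ki => Osp.ki Q ⊗ₜ Osp.ki Q
  | .p => Osp.p Q ⊗ₜ Osp.p Q

theorem Osp.isOsp_comulGen : IsOsp Q (Osp.comulGen Q) := by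
  have hs := Q.s_ne_zero
  have hs2 := Q.s_two
  obtain ⟨h1, h2, h3, h4, h5, h6, h7, h8, h9, h10, h11, h12⟩ := (Osp.isOsp_gen Q).nf
  have a1 := assoc_rule h1
  have a2 := assoc_rule h2
  have a3 := assoc_rule h3
  have a4 := assoc_rule h4
  have a5 := assoc_rule h5
  have a6 := assoc_rule h6
  have a7 := assoc_rule h7
  have a8 := assoc_rule h8
  have a9 := assoc_rule h9
  have a10 := assoc_rule h10
  have a11 := assoc_rule h11
  have a12 := assoc_rule h12
  constructor <;>
  · simp only [comulGen, ap, am, k, ki, p, pow_two, Q.pow_neg_half, Q.pow_half, mul_add, add_mul,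
      Algebra.TensorProduct.tmul_mul_tmul, mul_assoc, smul_mul_assoc, mul_smul_comm,
      TensorProduct.tmul_smul, ← TensorProduct.smul_tmul', smul_smul, TensorProduct.tmul_add,
      TensorProduct.add_tmul, TensorProduct.sub_tmul, TensorProduct.tmul_sub,
      h1, h2, h3, h4, h5, h6, h7, h8, h9, h10, h11, h12,
      a1, a2, a7, a9, one_mul, mul_one, Algebra.TensorProduct.one_def]
    try (match_scalars <;> field_simp <;> ring)

/-- The coproduct of `osp_q(1|2)`. -/
def Osp.comul : Osp Q →ₐ[ℂ] Osp Q ⊗[ℂ] Osp Q :=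
  Osp.lift (Osp.comulGen Q) (Osp.isOsp_comulGen Q)


/-- Names for the generators `A₋K`, `A₊K`, `K²P`, `Γ^q` of the coideal subalgebra. -/
inductive CoidGen
  | a | b | c | g

/-- The defining relations of the subalgebra generated by `A₋K`, `A₊K`, `K²P` and `Γ^q`. -/
structure IsCoid {R : Type*} [Ring R] [Algebra ℂ R] (x : CoidGen → R) : Prop where
  ca : x .c * x .a = (-(Q.s ^ 2)⁻¹) • (x .a * x .c)
  cb : x .c * x .b = (-Q.s ^ 2) • (x .b * x .c)
  ga : x .g * x .a = x .a * x .g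
  gb : x .g * x .b = x .b * x .g
  gc : x .g * x .c = x .c * x .g
  ba : x .b * x .a = ((Q.s ^ 2 - (Q.s ^ 2)⁻¹)⁻¹ * (Q.s ^ 2)⁻¹) • (x .c * x .c)
    + (-(Q.s ^ 2 - (Q.s ^ 2)⁻¹)⁻¹) • (1 : R) + (-(Q.s)⁻¹) • (x .c * x .g)
  ab : x .a * x .b = ((Q.s ^ 2 - (Q.s ^ 2)⁻¹)⁻¹ * Q.s ^ 2) • (x .c * x .c)
    + (-(Q.s ^ 2 - (Q.s ^ 2)⁻¹)⁻¹) • (1 : R) + Q.s • (x .c * x .g)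

/-- The elements `A₋K`, `A₊K`, `K²P`, `Γ^q` of `osp_q(1|2)`. -/
def Osp.coidGen : CoidGen → Osp Q
  | .a => Osp.am Q * Osp.k Q
  | .b => Osp.ap Q * Osp.k Q
  | .c => Osp.k Q ^ 2 * Osp.p Q
  | .g => Osp.casimir Q

theorem IsOsp.isCoid {R : Type*} [Ring R] [Algebra ℂ R] {x : OspGen → R} (hx : IsOsp Q x)
    {y : CoidGen → R} (ha : y .a = x .am * x .k) (hb : y .b = x .ap * x .k)
    (hc : y .c = x .k ^ 2 * x .p) (hg : y .g = (-(x .ap * x .am) + (Q.q - Q.q⁻¹)⁻¹ •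
    (Q.pow (-1 / 2) • x .k ^ 2 - Q.pow (1 / 2) • x .ki ^ 2)) * x .p) : IsCoid Q y := by
  have hs := Q.s_ne_zero
  have hs2 := Q.s_two
  have hs4 := Q.s_four
  obtain ⟨h1, h2, h3, h4, h5, h6, h7, h8, h9, h10, h11, h12⟩ := hx.nf
  have h13 : x .ki * x .k = x .k * x .ki := h10.trans h9.symm
  have a1 := Osp.assoc_rule h1
  have a2 := Osp.assoc_rule h2
  have a3 := Osp.assoc_rule h3
  have a4 := Osp.assoc_rule h4
  have a5 := Osp.assoc_rule h5
  have a6 := Osp.assoc_rule h6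
  have a7 := Osp.assoc_rule h7
  have a8 := Osp.assoc_rule h8
  have a9 := Osp.assoc_rule h9
  have a10 := Osp.assoc_rule h10
  have a11 := Osp.assoc_rule h11
  have a12 := Osp.assoc_rule h12
  constructor <;>
  · simp only [ha, hb, hc, hg, Q.pow_neg_half, Q.pow_half, Q.q_eq]
    simp only [pow_two (x .k), pow_two (x .ki), mul_add, add_mul,
      mul_assoc, smul_mul_assoc, mul_smul_comm, smul_smul, sub_mul, mul_sub, smul_sub, smul_add,
      neg_mul, mul_neg,
      h1, h2, h3, h4, h5, h6, h7, h8, h9, h10, h11, h12,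
      a1, a2, a3, a4, a5, a6, a7, a8, a9, a10, a11, a12, one_mul, mul_one]
    try (match_scalars <;> field_simp <;> ring)

theorem Osp.isCoid_coidGen : IsCoid Q (Osp.coidGen Q) :=
  (Osp.isOsp_gen Q).isCoid Q rfl rfl rfl rfl

/-- The coefficient of `A₋` on the weight vector `m`. -/
def Osp.weight (κ γ : ℂ) (m : ℤ) : ℂ :=
  (Q.s ^ 2 - (Q.s ^ 2)⁻¹)⁻¹ * ((Q.s)⁻¹ * (κ * Q.s ^ m) ^ 2 - Q.s * ((κ * Q.s ^ m) ^ 2)⁻¹)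
    - γ * (-1) ^ m

/-- Weight representations of `osp_q(1|2)` on functions on `ℤ`; they serve to show that the
relations `IsCoid` present the subalgebra `Coid` below. -/
def Osp.repGen (κ γ : ℂ) : OspGen → Module.End ℂ (ℤ → ℂ)
  | .ap => { toFun := fun f m => f (m - 1), map_add' := fun _ _ => rfl, map_smul' := fun _ _ => rfl }
  | .am => { toFun := fun f m => Osp.weight Q κ γ (m + 1) * f (m + 1)
             map_add' := fun _ _ => by ext; simp [mul_add]
             map_smul' := fun _ _ => by ext; simp [mul_left_comm] }
  | .k => { toFun := fun f m => (κ * Q.s ^ m) * f m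
            map_add' := fun _ _ => by ext; simp [mul_add]
            map_smul' := fun _ _ => by ext; simp [mul_left_comm] }
  | .ki => { toFun := fun f m => (κ * Q.s ^ m)⁻¹ * f m
             map_add' := fun _ _ => by ext; simp [mul_add]
             map_smul' := fun _ _ => by ext; simp [mul_left_comm] }
  | .p => { toFun := fun f m => (-1) ^ m * f m
            map_add' := fun _ _ => by ext; simp [mul_add]
            map_smul' := fun _ _ => by ext; simp [mul_left_comm] }

theorem Osp.isOsp_repGen (κ γ : ℂ) (hκ : κ ≠ 0) : IsOsp Q (Osp.repGen Q κ γ) := by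
  have hs := Q.s_ne_zero
  have hs2 := Q.s_two
  have hs4 := Q.s_four
  have n1 : (-1 : ℂ) ≠ 0 := by norm_num
  have hz : ∀ m : ℤ, Q.s ^ m ≠ 0 := fun m => zpow_ne_zero _ hs
  have hsq : ∀ m : ℤ, ((-1 : ℂ) ^ m) ^ 2 = 1 := fun m => by
    rw [← zpow_natCast, zpow_comm]; norm_num
  constructor <;> ext f m <;>
    simp only [repGen, Module.End.mul_apply, LinearMap.coe_mk, AddHom.coe_mk, LinearMap.smul_apply,
      LinearMap.add_apply, LinearMap.sub_apply, pow_two (_ : Module.End ℂ (ℤ → ℂ)), Pi.add_apply,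
      Pi.smul_apply, Pi.sub_apply, smul_eq_mul, Q.pow_neg_half, Q.pow_half, weight,
      zpow_add₀ hs, zpow_sub₀ hs, zpow_add₀ n1, zpow_sub₀ n1, zpow_one, sub_add_cancel,
      add_sub_cancel_right, LinearMap.zero_apply, Pi.zero_apply, Module.End.one_apply] <;>
    have h1 := hz m <;> have h2 := hsq m
  · field_simp
  · field_simp
  · field_simp
    ring
  · field_simp
    ring
  · field_simp
    ring
  · ring
  · ring
  · field_simp
  · field_simp
  · linear_combination (f m) * h2


/-- The power `b ^ m` for `m ≥ 0` and `a ^ (-m)` for `m < 0`. -/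
def coidPow {R : Type*} [Ring R] (x : CoidGen → R) : ℤ → R
  | .ofNat m => x .b ^ m
  | .negSucc m => x .a ^ (m + 1)

/-- The ordered monomials `c ^ i * g ^ j * b ^ m` and `c ^ i * g ^ j * a ^ m`. -/
def coidMon {R : Type*} [Ring R] (x : CoidGen → R) (t : ℕ × ℕ × ℤ) : R :=
  x .c ^ t.1 * x .g ^ t.2.1 * coidPow x t.2.2

/-- The elements of the free algebra that have a normal form modulo the relations `IsCoid`. -/
def coidNF : Submodule ℂ (FreeAlgebra ℂ CoidGen) where
  carrier := {u | ∃ F : ℕ × ℕ × ℤ →₀ ℂ, ∀ (R : Type) [Ring R] [Algebra ℂ R] (x : CoidGen → R),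
    IsCoid Q x → FreeAlgebra.lift ℂ x u = F.sum fun t r => r • coidMon x t}
  add_mem' := by
    rintro u v ⟨F, hF⟩ ⟨G, hG⟩
    refine ⟨F + G, fun R _ _ x hx => ?_⟩
    rw [map_add, hF R x hx, hG R x hx, Finsupp.sum_add_index'] <;> simp [add_smul]
  zero_mem' := ⟨0, fun R _ _ x hx => by simp⟩
  smul_mem' := by
    rintro r u ⟨F, hF⟩
    refine ⟨r • F, fun R _ _ x hx => ?_⟩
    rw [map_smul, hF R x hx, Finsupp.sum_smul_index' (by simp), Finsupp.smul_sum]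
    simp [mul_smul]

variable {Q}

/-- The ordered monomial in the free algebra. -/
theorem lift_coidMon {R : Type*} [Ring R] [Algebra ℂ R] (x : CoidGen → R) (t : ℕ × ℕ × ℤ) :
    FreeAlgebra.lift ℂ x (coidMon (FreeAlgebra.ι ℂ) t) = coidMon x t := by
  obtain ⟨i, j, m⟩ := t
  cases m <;> simp [coidMon, coidPow]

theorem coidMon_mem (t : ℕ × ℕ × ℤ) : coidMon (FreeAlgebra.ι ℂ) t ∈ coidNF Q :=
  ⟨Finsupp.single t 1, fun R _ _ x hx => by rw [lift_coidMon]; simp⟩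

theorem coidNF_congr {u v : FreeAlgebra ℂ CoidGen} (hv : v ∈ coidNF Q)
    (h : ∀ (R : Type) [Ring R] [Algebra ℂ R] (x : CoidGen → R),
      IsCoid Q x → FreeAlgebra.lift ℂ x u = FreeAlgebra.lift ℂ x v) : u ∈ coidNF Q := by
  obtain ⟨F, hF⟩ := hv
  exact ⟨F, fun R _ _ x hx => (h R x hx).trans (hF R x hx)⟩

theorem pow_comm_of {R : Type*} [Ring R] [Algebra ℂ R] {a c : R} {r : ℂ}
    (h : a * c = r • (c * a)) (i : ℕ) : a * c ^ i = r ^ i • (c ^ i * a) := by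
  induction i with
  | zero => simp
  | succ i ih =>
    rw [pow_succ, ← mul_assoc, ih, smul_mul_assoc, mul_assoc, h, mul_smul_comm, smul_smul,
      ← mul_assoc, ← pow_succ, ← pow_succ]

theorem IsCoid.swap {R : Type*} [Ring R] [Algebra ℂ R] {x : CoidGen → R} (h : IsCoid Q x) :
    (x .a * x .c = (-Q.s ^ 2) • (x .c * x .a)) ∧
    (x .b * x .c = (-(Q.s ^ 2)⁻¹) • (x .c * x .b)) := by
  have hs := Q.s_ne_zero
  constructor
  · rw [h.ca, smul_smul]
    simp [hs]
  · rw [h.cb, smul_smul]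
    simp [hs]

theorem gen_mul_mon (y : CoidGen) (t : ℕ × ℕ × ℤ) :
    FreeAlgebra.ι ℂ y * coidMon (FreeAlgebra.ι ℂ) t ∈ coidNF Q := by
  obtain ⟨i, j, m⟩ := t
  cases y with
  | c =>
    have : FreeAlgebra.ι ℂ CoidGen.c * coidMon (FreeAlgebra.ι ℂ) (i, j, m)
        = coidMon (FreeAlgebra.ι ℂ) (i + 1, j, m) := by
      simp [coidMon, pow_succ', mul_assoc]
    rw [this]; exact coidMon_mem _
  | g =>
    refine coidNF_congr (coidMon_mem (i, j + 1, m)) fun R _ _ x hx => ?_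
    rw [map_mul, lift_coidMon, lift_coidMon, FreeAlgebra.lift_ι_apply]
    have : Commute (x .g) (x .c ^ i) := (show Commute (x .g) (x .c) from hx.gc).pow_right i
    simp only [coidMon, pow_succ', ← mul_assoc, this.eq]
  | a =>
    have key : ∀ (R : Type) [Ring R] [Algebra ℂ R] (x : CoidGen → R), IsCoid Q x →
        x .a * coidMon x (i, j, m) = (-Q.s ^ 2) ^ i • (x .c ^ i * x .g ^ j * (x .a * coidPow x m)) := by
      intro R _ _ x hx
      have h1 := pow_comm_of hx.swap.1 i
      have h2 : Commute (x .a) (x .g ^ j) := (show Commute (x .a) (x .g) from hx.ga.symm).pow_right j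
      simp only [coidMon]
      rw [mul_assoc, ← mul_assoc, h1, smul_mul_assoc, mul_assoc, ← mul_assoc (x .a), h2.eq]
      simp only [mul_assoc]
    cases m with
    | negSucc m =>
      refine coidNF_congr ((coidNF Q).smul_mem ((-Q.s ^ 2) ^ i)
        (coidMon_mem (i, j, .negSucc (m + 1)))) fun R _ _ x hx => ?_
      rw [map_mul, map_smul, lift_coidMon, lift_coidMon, FreeAlgebra.lift_ι_apply, key R x hx]
      simp only [coidMon, coidPow, pow_succ']
    | ofNat m =>
      cases m with
      | zero =>
        refine coidNF_congr ((coidNF Q).smul_mem ((-Q.s ^ 2) ^ i)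
          (coidMon_mem (i, j, .negSucc 0))) fun R _ _ x hx => ?_
        rw [map_mul, map_smul, lift_coidMon, lift_coidMon, FreeAlgebra.lift_ι_apply, key R x hx]
        simp [coidMon, coidPow]
      | succ m =>
        refine coidNF_congr ((coidNF Q).smul_mem ((-Q.s ^ 2) ^ i)
          ((coidNF Q).add_mem ((coidNF Q).add_mem
            ((coidNF Q).smul_mem ((Q.s ^ 2 - (Q.s ^ 2)⁻¹)⁻¹ * Q.s ^ 2) (coidMon_mem (i + 2, j, .ofNat m)))
            ((coidNF Q).smul_mem (-(Q.s ^ 2 - (Q.s ^ 2)⁻¹)⁻¹) (coidMon_mem (i, j, .ofNat m))))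
            ((coidNF Q).smul_mem Q.s (coidMon_mem (i + 1, j + 1, .ofNat m)))))
          fun R _ _ x hx => ?_
        have h2 : x .c * x .g ^ j = x .g ^ j * x .c :=
          ((show Commute (x .c) (x .g) from hx.gc.symm).pow_right j).eq
        simp only [map_mul, map_smul, map_add, lift_coidMon, FreeAlgebra.lift_ι_apply, key R x hx]
        congr 1
        simp only [coidMon, coidPow]
        rw [pow_succ' (x .b) m, ← mul_assoc (x .a), hx.ab]
        simp only [add_mul, mul_add, smul_mul_assoc, mul_smul_comm, mul_assoc, one_mul,
          pow_succ, h2, Osp.assoc_rule h2]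
  | b =>
    have key : ∀ (R : Type) [Ring R] [Algebra ℂ R] (x : CoidGen → R), IsCoid Q x →
        x .b * coidMon x (i, j, m)
          = (-(Q.s ^ 2)⁻¹) ^ i • (x .c ^ i * x .g ^ j * (x .b * coidPow x m)) := by
      intro R _ _ x hx
      have h1 := pow_comm_of hx.swap.2 i
      have h2 : Commute (x .b) (x .g ^ j) := (show Commute (x .b) (x .g) from hx.gb.symm).pow_right j
      simp only [coidMon]
      rw [mul_assoc, ← mul_assoc, h1, smul_mul_assoc, mul_assoc, ← mul_assoc (x .b), h2.eq]
      simp only [mul_assoc]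
    cases m with
    | ofNat m =>
      refine coidNF_congr ((coidNF Q).smul_mem ((-(Q.s ^ 2)⁻¹) ^ i)
        (coidMon_mem (i, j, .ofNat (m + 1)))) fun R _ _ x hx => ?_
      rw [map_mul, map_smul, lift_coidMon, lift_coidMon, FreeAlgebra.lift_ι_apply, key R x hx]
      simp only [coidMon, coidPow, pow_succ']
    | negSucc m =>
      have hm : ∃ l : ℤ, ∀ (R : Type) [Ring R] (x : CoidGen → R), coidPow x l = x .a ^ m := by
        cases m with
        | zero => exact ⟨.ofNat 0, fun R _ x => by simp [coidPow]⟩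
        | succ m => exact ⟨.negSucc m, fun R _ x => rfl⟩
      obtain ⟨l, hl⟩ := hm
      refine coidNF_congr ((coidNF Q).smul_mem ((-(Q.s ^ 2)⁻¹) ^ i)
        ((coidNF Q).add_mem ((coidNF Q).add_mem
          ((coidNF Q).smul_mem ((Q.s ^ 2 - (Q.s ^ 2)⁻¹)⁻¹ * (Q.s ^ 2)⁻¹) (coidMon_mem (i + 2, j, l)))
          ((coidNF Q).smul_mem (-(Q.s ^ 2 - (Q.s ^ 2)⁻¹)⁻¹) (coidMon_mem (i, j, l))))
          ((coidNF Q).smul_mem (-(Q.s)⁻¹) (coidMon_mem (i + 1, j + 1, l)))))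
        fun R _ _ x hx => ?_
      have h2 : x .c * x .g ^ j = x .g ^ j * x .c :=
        ((show Commute (x .c) (x .g) from hx.gc.symm).pow_right j).eq
      simp only [map_mul, map_smul, map_add, lift_coidMon, FreeAlgebra.lift_ι_apply, key R x hx]
      congr 1
      simp only [coidMon, hl R x]
      rw [show coidPow x (.negSucc m) = x .a ^ (m + 1) from rfl, pow_succ' (x .a) m,
        ← mul_assoc (x .b), hx.ba]
      simp only [add_mul, mul_add, smul_mul_assoc, mul_smul_comm, mul_assoc, one_mul,
        pow_succ, h2, Osp.assoc_rule h2]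

theorem mul_mem_coidNF (u v : FreeAlgebra ℂ CoidGen) (hv : v ∈ coidNF Q) : u * v ∈ coidNF Q := by
  induction u using FreeAlgebra.induction generalizing v with
  | grade0 r =>
    rw [← Algebra.smul_def]
    exact (coidNF Q).smul_mem r hv
  | grade1 y =>
    obtain ⟨F, hF⟩ := hv
    refine coidNF_congr (v := F.sum fun t r => r • (FreeAlgebra.ι ℂ y * coidMon (FreeAlgebra.ι ℂ) t))
      ((coidNF Q).sum_mem fun t _ => (coidNF Q).smul_mem _ (gen_mul_mon y t)) fun R _ _ x hx => ?_
    rw [map_mul, hF R x hx, Finsupp.sum, Finsupp.sum, map_sum, Finset.mul_sum]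
    refine Finset.sum_congr rfl fun t _ => ?_
    rw [map_smul, map_mul, lift_coidMon, mul_smul_comm]
  | mul a b ha hb => rw [mul_assoc]; exact ha _ (hb _ hv)
  | add a b ha hb => rw [add_mul]; exact (coidNF Q).add_mem (ha _ hv) (hb _ hv)

theorem exists_coidNF (u : FreeAlgebra ℂ CoidGen) : u ∈ coidNF Q := by
  have h := mul_mem_coidNF (Q := Q) u (coidMon (FreeAlgebra.ι ℂ) (0, 0, .ofNat 0)) (coidMon_mem _)
  simpa [coidMon, coidPow] using h

variable (Q)

/-- A polynomial in two variables vanishing at enough points has zero coefficients. -/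
theorem coeff_zero_of_vanish (h : ℕ × ℕ →₀ ℂ) (G : ℂ → Set ℂ)
    (hG : ∀ z, z ≠ 0 → (G z).Infinite)
    (hv : ∀ z, z ≠ 0 → ∀ γ ∈ G z, (h.sum fun t r => r * (z ^ t.1 * γ ^ t.2)) = 0) : h = 0 := by
  classical
  have h1 : ∀ z, z ≠ 0 → ∀ j, (∑ t ∈ h.support with t.2 = j, h t * z ^ t.1) = 0 := by
    intro z hz j
    let p : Polynomial ℂ := ∑ t ∈ h.support, Polynomial.monomial t.2 (h t * z ^ t.1)
    have hp : p = 0 := by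
      refine Polynomial.eq_zero_of_infinite_isRoot p ((hG z hz).mono fun γ hγ => ?_)
      have := hv z hz γ hγ
      simp only [Set.mem_ofPred_eq, Polynomial.IsRoot, p, Polynomial.eval_finsetSum,
        Polynomial.eval_monomial]
      rw [← this, Finsupp.sum]
      exact Finset.sum_congr rfl fun t _ => by ring
    have := congrArg (fun p => Polynomial.coeff p j) hp
    simpa [p, Polynomial.finsetSum_coeff, Polynomial.coeff_monomial, Finset.sum_filter] using this
  ext ⟨i, j⟩
  let p : Polynomial ℂ := ∑ t ∈ h.support with t.2 = j, Polynomial.monomial t.1 (h t)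
  have hp : p = 0 := by
    refine Polynomial.eq_zero_of_infinite_isRoot p
      ((Set.Finite.infinite_compl (Set.finite_singleton (0 : ℂ))).mono fun z hz => ?_)
    simp only [Set.mem_ofPred_eq, Polynomial.IsRoot, p, Polynomial.eval_finsetSum,
        Polynomial.eval_monomial]
    exact h1 z (by simpa using hz) j
  have hc := congrArg (fun p => Polynomial.coeff p i) hp
  simp only [p, Polynomial.finsetSum_coeff, Polynomial.coeff_monomial, Polynomial.coeff_zero,
    Finset.sum_filter] at hc
  by_contra hne
  apply hne
  rw [Finset.sum_eq_single (i, j)] at hc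
  · simpa using hc
  · rintro ⟨i', j'⟩ _ hb
    split_ifs with e1
    · have e2 : i' ≠ i := fun e2 => hb (by rw [e2]; exact congrArg _ e1)
      simp [Polynomial.coeff_monomial, e2]
    · simp
  · intro hh
    simpa using hh

/-- The weight representation of `osp_q(1|2)`. -/
def Osp.rep (κ γ : ℂ) (hκ : κ ≠ 0) : Osp Q →ₐ[ℂ] Module.End ℂ (ℤ → ℂ) :=
  Osp.lift (Osp.repGen Q κ γ) (Osp.isOsp_repGen Q κ γ hκ)

/-- The standard basis functions on `ℤ`. -/
def delta (m : ℤ) : ℤ → ℂ := fun l => if l = m then 1 else 0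

theorem Osp.rep_a (κ γ : ℂ) (hκ : κ ≠ 0) (m : ℤ) :
    Osp.rep Q κ γ hκ (Osp.coidGen Q .a) (delta m)
      = (Osp.weight Q κ γ m * (κ * Q.s ^ m)) • delta (m - 1) := by
  ext l
  simp only [coidGen, am, k, map_mul, rep, lift_gen, repGen, Module.End.mul_apply,
    LinearMap.coe_mk, AddHom.coe_mk, delta, Pi.smul_apply, smul_eq_mul]
  by_cases h : l = m - 1
  · subst h; simp
  · have : l + 1 ≠ m := fun h' => h (by omega)
    simp [h, this]

theorem Osp.rep_b (κ γ : ℂ) (hκ : κ ≠ 0) (m : ℤ) :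
    Osp.rep Q κ γ hκ (Osp.coidGen Q .b) (delta m) = (κ * Q.s ^ m) • delta (m + 1) := by
  ext l
  simp only [coidGen, ap, k, map_mul, rep, lift_gen, repGen, Module.End.mul_apply,
    LinearMap.coe_mk, AddHom.coe_mk, delta, Pi.smul_apply, smul_eq_mul]
  by_cases h : l = m + 1
  · subst h; simp
  · have : l - 1 ≠ m := fun h' => h (by omega)
    simp [h, this]

theorem Osp.rep_c (κ γ : ℂ) (hκ : κ ≠ 0) (m : ℤ) :
    Osp.rep Q κ γ hκ (Osp.coidGen Q .c) (delta m)
      = ((κ * Q.s ^ m) ^ 2 * (-1) ^ m) • delta m := by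
  ext l
  simp only [coidGen, p, k, map_mul, map_pow, rep, lift_gen, repGen, Module.End.mul_apply,
    LinearMap.coe_mk, AddHom.coe_mk, delta, Pi.smul_apply, smul_eq_mul, pow_two]
  by_cases h : l = m
  · subst h; simp [mul_assoc]
  · simp [h]

theorem Osp.rep_g (κ γ : ℂ) (hκ : κ ≠ 0) (m : ℤ) :
    Osp.rep Q κ γ hκ (Osp.coidGen Q .g) (delta m) = γ • delta m := by
  have hsq : ((-1 : ℂ) ^ m) * (-1) ^ m = 1 := by
    rw [← mul_zpow]; norm_num
  ext l
  simp only [coidGen, casimir, ap, am, ki, p, k, map_mul, map_pow, map_add, map_sub, map_neg,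
    map_smul, rep, lift_gen, repGen, Module.End.mul_apply, LinearMap.add_apply,
    LinearMap.sub_apply, LinearMap.neg_apply, LinearMap.smul_apply, Pi.add_apply, Pi.sub_apply,
    Pi.neg_apply, Q.pow_half, Q.pow_neg_half, Q.q_eq,
    LinearMap.coe_mk, AddHom.coe_mk, delta, Pi.smul_apply, smul_eq_mul, pow_two, sub_add_cancel]
  by_cases h : l = m
  · subst h
    simp only [if_true, mul_one, weight, pow_two, mul_inv]
    linear_combination γ * hsq
  · simp [h]

theorem Osp.rep_pow (κ γ : ℂ) (hκ : κ ≠ 0) (hw : ∀ m, Osp.weight Q κ γ m ≠ 0) (m : ℤ) :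
    ∃ ω : ℂ, ω ≠ 0 ∧ Osp.rep Q κ γ hκ (coidPow (Osp.coidGen Q) m) (delta 0) = ω • delta m := by
  have hz : ∀ l : ℤ, κ * Q.s ^ l ≠ 0 := fun l => mul_ne_zero hκ (zpow_ne_zero _ Q.s_ne_zero)
  have ha : ∀ n : ℕ, ∃ ω : ℂ, ω ≠ 0 ∧
      Osp.rep Q κ γ hκ (Osp.coidGen Q .a ^ n) (delta 0) = ω • delta (-n) := by
    intro n
    induction n with
    | zero => exact ⟨1, one_ne_zero, by simp⟩
    | succ n ih =>
      obtain ⟨ω, h0, h⟩ := ih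
      refine ⟨ω * (Osp.weight Q κ γ (-n) * (κ * Q.s ^ (-n : ℤ))),
        mul_ne_zero h0 (mul_ne_zero (hw _) (hz _)), ?_⟩
      rw [pow_succ', map_mul, Module.End.mul_apply, h, map_smul, Osp.rep_a, smul_smul]
      congr 2
      push_cast
      ring
  have hb : ∀ n : ℕ, ∃ ω : ℂ, ω ≠ 0 ∧
      Osp.rep Q κ γ hκ (Osp.coidGen Q .b ^ n) (delta 0) = ω • delta n := by
    intro n
    induction n with
    | zero => exact ⟨1, one_ne_zero, by simp⟩
    | succ n ih =>
      obtain ⟨ω, h0, h⟩ := ih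
      refine ⟨ω * (κ * Q.s ^ (n : ℤ)), mul_ne_zero h0 (hz _), ?_⟩
      rw [pow_succ', map_mul, Module.End.mul_apply, h, map_smul, Osp.rep_b, smul_smul]
      congr 2
  cases m with
  | ofNat n => exact hb n
  | negSucc n =>
    obtain ⟨ω, h0, h⟩ := ha (n + 1)
    exact ⟨ω, h0, h⟩

theorem Osp.rep_mon (κ γ : ℂ) (hκ : κ ≠ 0) (hw : ∀ m, Osp.weight Q κ γ m ≠ 0) (m : ℤ) :
    ∃ ω : ℂ, ω ≠ 0 ∧ ∀ i j, Osp.rep Q κ γ hκ (coidMon (Osp.coidGen Q) (i, j, m)) (delta 0)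
      = (ω * (((κ * Q.s ^ m) ^ 2 * (-1) ^ m) ^ i * γ ^ j)) • delta m := by
  obtain ⟨ω, h0, h⟩ := Osp.rep_pow Q κ γ hκ hw m
  refine ⟨ω, h0, fun i j => ?_⟩
  have hc : ∀ i, Osp.rep Q κ γ hκ (Osp.coidGen Q .c ^ i) (delta m)
      = ((κ * Q.s ^ m) ^ 2 * (-1) ^ m) ^ i • delta m := by
    intro i
    induction i with
    | zero => simp
    | succ i ih => rw [pow_succ', map_mul, Module.End.mul_apply, ih, map_smul, Osp.rep_c, smul_smul,
        ← pow_succ]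
  have hg : ∀ i, Osp.rep Q κ γ hκ (Osp.coidGen Q .g ^ i) (delta m) = γ ^ i • delta m := by
    intro i
    induction i with
    | zero => simp
    | succ i ih => rw [pow_succ', map_mul, Module.End.mul_apply, ih, map_smul, Osp.rep_g, smul_smul,
        ← pow_succ]
  simp only [coidMon]
  rw [map_mul, map_mul, Module.End.mul_apply, Module.End.mul_apply, h, map_smul, hg, map_smul,
    map_smul, hc, smul_smul, smul_smul]
  congr 1
  ring

/-- The ordered monomials are linearly independent in `osp_q(1|2)`. -/
theorem coidMon_independent (F : ℕ × ℕ × ℤ →₀ ℂ)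
    (hF : (F.sum fun t r => r • coidMon (Osp.coidGen Q) t) = 0) : F = 0 := by
  classical
  ext ⟨i, j, m⟩
  have hs := Q.s_ne_zero
  have n1 : ((-1 : ℂ) ^ m) ≠ 0 := zpow_ne_zero _ (by norm_num)
  let e : ℕ × ℕ ↪ ℕ × ℕ × ℤ := ⟨fun t => (t.1, t.2, m), fun t t' h => by
    simp only [Prod.mk.injEq] at h
    exact Prod.ext h.1 h.2.1⟩
  let h : ℕ × ℕ →₀ ℂ := F.comapDomain e e.injective.injOn
  have he : ∀ t : ℕ × ℕ, e t = (t.1, t.2, m) := fun _ => rfl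
  have hh : ∀ t : ℕ × ℕ, h t = F (t.1, t.2, m) := fun _ => rfl
  have hκ : ∀ z : ℂ, z ≠ 0 → ∃ κ : ℂ, κ ≠ 0 ∧ (κ * Q.s ^ m) ^ 2 * (-1) ^ m = z := by
    intro z hz
    obtain ⟨w, hw⟩ := IsAlgClosed.exists_pow_nat_eq (z * ((-1 : ℂ) ^ m)⁻¹) (n := 2) (by norm_num)
    have hsm : Q.s ^ m ≠ 0 := zpow_ne_zero _ hs
    refine ⟨w * (Q.s ^ m)⁻¹, ?_, ?_⟩
    · refine mul_ne_zero ?_ (inv_ne_zero hsm)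
      rintro rfl
      have : z * ((-1 : ℂ) ^ m)⁻¹ ≠ 0 := mul_ne_zero hz (inv_ne_zero n1)
      exact this (by rw [← hw]; simp)
    · rw [inv_mul_cancel_right₀ hsm, hw, inv_mul_cancel_right₀ n1]
  choose! κ hκ0 hκz using hκ
  have h0 : h = 0 := by
    refine coeff_zero_of_vanish h (fun z => {γ | ∀ l, Osp.weight Q (κ z) γ l ≠ 0}) ?_ ?_
    · intro z hz
      have hcount : ({γ : ℂ | ∀ l, Osp.weight Q (κ z) γ l ≠ 0}ᶜ).Countable := by
        have : {γ : ℂ | ∀ l, Osp.weight Q (κ z) γ l ≠ 0}ᶜ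
            = ⋃ l : ℤ, {γ | Osp.weight Q (κ z) γ l = 0} := by
          ext γ; simp
        rw [this]
        refine Set.countable_iUnion fun l => Set.Subsingleton.countable ?_
        intro γ hγ γ' hγ'
        have hl : ((-1 : ℂ) ^ l) ≠ 0 := zpow_ne_zero _ (by norm_num)
        simp only [Set.mem_ofPred_eq, Osp.weight] at hγ hγ'
        exact mul_right_cancel₀ hl ((sub_eq_zero.1 hγ).symm.trans (sub_eq_zero.1 hγ'))
      intro hfin
      refine not_countable_complex ?_
      rw [← Set.union_compl_self {γ : ℂ | ∀ l, Osp.weight Q (κ z) γ l ≠ 0}]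
      exact hfin.countable.union hcount
    · intro z hz γ hγ
      have hω := Osp.rep_mon Q (κ z) γ (hκ0 z hz) hγ
      choose ω hω0 hω using hω
      have := congrArg (fun u => Osp.rep Q (κ z) γ (hκ0 z hz) u (delta 0) m) hF
      simp only [Finsupp.sum, map_sum, map_zero, map_smul, LinearMap.sum_apply,
        LinearMap.smul_apply, Finset.sum_apply, Pi.smul_apply, LinearMap.zero_apply,
        Pi.zero_apply] at this
      have h2 : ∀ t : ℕ × ℕ × ℤ, F t • Osp.rep Q (κ z) γ (hκ0 z hz)
          (coidMon (Osp.coidGen Q) t) (delta 0) m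
          = if t.2.2 = m then ω m * (F t * (z ^ t.1 * γ ^ t.2.1)) else 0 := by
        rintro ⟨i', j', m'⟩
        rw [hω]
        simp only [Pi.smul_apply, delta, smul_eq_mul]
        by_cases hm : m' = m
        · subst hm
          simp only [if_true, hκz z hz]
          ring
        · simp [hm, Ne.symm hm]
      simp only [h2] at this
      rw [← Finset.sum_filter, ← Finset.mul_sum] at this
      have h3 := (mul_eq_zero.1 this).resolve_left (hω0 m)
      rw [← h3, Finsupp.sum]
      refine Finset.sum_bij (fun t _ => e t) ?_ ?_ ?_ ?_
      · intro t ht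
        have ht' : F (t.1, t.2, m) ≠ 0 := by
          rw [← hh]; exact Finsupp.mem_support_iff.1 ht
        simp [he, ht']
      · intro t _ t' _ htt
        exact e.injective htt
      · rintro ⟨i', j', m'⟩ ht
        simp only [Finset.mem_filter, Finsupp.mem_support_iff] at ht
        obtain ⟨ht, rfl⟩ := ht
        exact ⟨(i', j'), Finsupp.mem_support_iff.2 ht, rfl⟩
      · intro t _
        rw [he, hh]
  exact DFunLike.congr_fun h0 (i, j)

theorem coid_relation {R : Type} [Ring R] [Algebra ℂ R] {x : CoidGen → R} (hx : IsCoid Q x)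
    {u v : FreeAlgebra ℂ CoidGen}
    (h : FreeAlgebra.lift ℂ (Osp.coidGen Q) u = FreeAlgebra.lift ℂ (Osp.coidGen Q) v) :
    FreeAlgebra.lift ℂ x u = FreeAlgebra.lift ℂ x v := by
  obtain ⟨F, hF⟩ := exists_coidNF (Q := Q) (u - v)
  have h1 : F = 0 := by
    apply coidMon_independent Q
    rw [← hF _ _ (Osp.isCoid_coidGen Q), map_sub, h, sub_self]
  have h2 := hF R x hx
  rw [h1, map_sub, Finsupp.sum_zero_index] at h2
  exact sub_eq_zero.1 h2

/-- The subalgebra of `osp_q(1|2)` generated by `A₋K`, `A₊K`, `K²P` and `Γ^q`. -/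
def Coid : Subalgebra ℂ (Osp Q) := Algebra.adjoin ℂ (Set.range (Osp.coidGen Q))

/-- The generators of the subalgebra, as its elements. -/
def Coid.gen (i : CoidGen) : Coid Q := ⟨Osp.coidGen Q i, Algebra.subset_adjoin ⟨i, rfl⟩⟩

theorem Coid.isCoid_gen : IsCoid Q (Coid.gen Q) := by
  have h := Osp.isCoid_coidGen Q
  constructor <;> apply Subtype.ext
  · exact h.ca
  · exact h.cb
  · exact h.ga
  · exact h.gb
  · exact h.gc
  · exact h.ba
  · exact h.ab

theorem Coid.exists_free (y : Coid Q) :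
    ∃ u, FreeAlgebra.lift ℂ (Osp.coidGen Q) u = (y : Osp Q) := by
  have := y.2
  change (y : Osp Q) ∈ Algebra.adjoin ℂ (Set.range (Osp.coidGen Q)) at this
  rw [Algebra.adjoin_range_eq_range_freeAlgebra_lift] at this
  exact this

variable {Q}

/-- Algebra morphisms on the subalgebra, from the images of its generators. -/
def Coid.lift {R : Type} [Ring R] [Algebra ℂ R] (x : CoidGen → R) (hx : IsCoid Q x) :
    Coid Q →ₐ[ℂ] R where
  toFun y := FreeAlgebra.lift ℂ x (Classical.choose (Coid.exists_free Q y))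
  map_one' := by
    rw [← map_one (FreeAlgebra.lift ℂ x)]
    apply coid_relation Q hx
    rw [Classical.choose_spec (Coid.exists_free Q 1)]
    simp
  map_mul' y z := by
    rw [← map_mul (FreeAlgebra.lift ℂ x)]
    apply coid_relation Q hx
    rw [Classical.choose_spec (Coid.exists_free Q (y * z)), map_mul,
      Classical.choose_spec (Coid.exists_free Q y), Classical.choose_spec (Coid.exists_free Q z)]
    rfl
  map_zero' := by
    rw [← map_zero (FreeAlgebra.lift ℂ x)]
    apply coid_relation Q hx
    rw [Classical.choose_spec (Coid.exists_free Q 0)]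
    simp
  map_add' y z := by
    rw [← map_add (FreeAlgebra.lift ℂ x)]
    apply coid_relation Q hx
    rw [Classical.choose_spec (Coid.exists_free Q (y + z)), map_add,
      Classical.choose_spec (Coid.exists_free Q y), Classical.choose_spec (Coid.exists_free Q z)]
    rfl
  commutes' r := by
    rw [← AlgHom.commutes (FreeAlgebra.lift ℂ x)]
    apply coid_relation Q hx
    rw [Classical.choose_spec (Coid.exists_free Q _), AlgHom.commutes]
    rfl

theorem Coid.lift_gen {R : Type} [Ring R] [Algebra ℂ R] (x : CoidGen → R) (hx : IsCoid Q x)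
    (i : CoidGen) : Coid.lift x hx (Coid.gen Q i) = x i := by
  have h : FreeAlgebra.lift ℂ x (Classical.choose (Coid.exists_free Q (Coid.gen Q i)))
      = FreeAlgebra.lift ℂ x (FreeAlgebra.ι ℂ i) := by
    apply coid_relation Q hx
    rw [Classical.choose_spec (Coid.exists_free Q (Coid.gen Q i)), FreeAlgebra.lift_ι_apply]
    rfl
  rw [FreeAlgebra.lift_ι_apply] at h
  exact h


variable (Q)

theorem Osp.comul_gen (i : OspGen) : Osp.comul Q (Osp.gen Q i) = Osp.comulGen Q i :=
  Osp.lift_gen _ _ i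

/-- The values of the coproduct on the generators of the coideal subalgebra, as elements of
`osp_q(1|2) ⊗ Coid`. -/
def Coid.comulGen : CoidGen → Osp Q ⊗[ℂ] Coid Q
  | .a => (Osp.am Q * Osp.k Q) ⊗ₜ Coid.gen Q .c + 1 ⊗ₜ Coid.gen Q .a
  | .b => (Osp.ap Q * Osp.k Q) ⊗ₜ Coid.gen Q .c + 1 ⊗ₜ Coid.gen Q .b
  | .c => (Osp.k Q ^ 2 * Osp.p Q) ⊗ₜ Coid.gen Q .c
  | .g => (-Q.pow (1 / 2)) • ((Osp.am Q * Osp.ki Q * Osp.p Q) ⊗ₜ Coid.gen Q .b)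
      + Q.pow (-1 / 2) • ((Osp.ap Q * Osp.ki Q * Osp.p Q) ⊗ₜ Coid.gen Q .a)
      + Q.num (1 / 2) • ((Osp.ki Q ^ 2 * Osp.p Q) ⊗ₜ Coid.gen Q .c)
      + Osp.casimir Q ⊗ₜ Coid.gen Q .c + (Osp.ki Q ^ 2 * Osp.p Q) ⊗ₜ Coid.gen Q .g

/-- The inclusion of `osp_q(1|2) ⊗ Coid` in `osp_q(1|2) ⊗ osp_q(1|2)`. -/
def Coid.incl : Osp Q ⊗[ℂ] Coid Q →ₐ[ℂ] Osp Q ⊗[ℂ] Osp Q :=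
  Algebra.TensorProduct.map (AlgHom.id ℂ (Osp Q)) (Coid Q).val

theorem Coid.incl_injective : Function.Injective (Coid.incl Q) :=
  Module.Flat.lTensor_preserves_injective_linearMap (M := Osp Q) (Coid Q).val.toLinearMap
    Subtype.val_injective

theorem Coid.incl_tmul (u : Osp Q) (y : Coid Q) : Coid.incl Q (u ⊗ₜ y) = u ⊗ₜ (y : Osp Q) := rfl

theorem Coid.incl_comulGen (i : CoidGen) :
    Coid.incl Q (Coid.comulGen Q i) = Osp.comul Q (Coid.gen Q i) := by
  have hs := Q.s_ne_zero
  have hs2 := Q.s_two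
  have hs4 := Q.s_four
  obtain ⟨h1, h2, h3, h4, h5, h6, h7, h8, h9, h10, h11, h12⟩ := (Osp.isOsp_gen Q).nf
  have a1 := Osp.assoc_rule h1
  have a2 := Osp.assoc_rule h2
  have a3 := Osp.assoc_rule h3
  have a4 := Osp.assoc_rule h4
  have a5 := Osp.assoc_rule h5
  have a6 := Osp.assoc_rule h6
  have a7 := Osp.assoc_rule h7
  have a8 := Osp.assoc_rule h8
  have a9 := Osp.assoc_rule h9
  have a10 := Osp.assoc_rule h10
  have a11 := Osp.assoc_rule h11
  have a12 := Osp.assoc_rule h12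
  cases i <;>
  · simp only [comulGen, gen, Osp.coidGen, Osp.casimir, Osp.ap, Osp.am, Osp.k, Osp.ki, Osp.p,
      map_add, map_smul, map_mul, map_pow, map_sub, map_neg, Coid.incl_tmul, Osp.comul_gen]
    simp only [Osp.comulGen, Osp.ap, Osp.am, Osp.k, Osp.ki, Osp.p, pow_two (Osp.gen _ _),
      pow_two (_ ⊗ₜ[ℂ] _), Q.pow_neg_half,
      QDeformation.num, Q.pow_neg, Q.pow_half, Q.q_eq,
      mul_add, add_mul, sub_mul, mul_sub, smul_sub, smul_add, neg_mul, mul_neg,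
      Algebra.TensorProduct.tmul_mul_tmul, mul_assoc, smul_mul_assoc, mul_smul_comm,
      TensorProduct.tmul_smul, ← TensorProduct.smul_tmul', smul_smul, TensorProduct.tmul_add,
      TensorProduct.add_tmul, TensorProduct.sub_tmul, TensorProduct.tmul_sub,
      TensorProduct.neg_tmul, TensorProduct.tmul_neg,
      h1, h2, h3, h4, h5, h6, h7, h8, h9, h10, h11, h12,
      a1, a2, a3, a4, a5, a6, a7, a8, a9, a10, a11, a12, one_mul, mul_one]
    try (match_scalars <;> field_simp <;> ring)

/-- `Coid` is a left coideal. -/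
theorem Coid.comul_mem (y : Coid Q) : Osp.comul Q y ∈ (Coid.incl Q).range := by
  have h : Coid Q ≤ (Coid.incl Q).range.comap (Osp.comul Q) := by
    refine Algebra.adjoin_le ?_
    rintro _ ⟨i, rfl⟩
    exact ⟨Coid.comulGen Q i, Coid.incl_comulGen Q i⟩
  exact h y.2

/-- The restriction of the coproduct to `Coid`, with values in `osp_q(1|2) ⊗ Coid`. -/
def Coid.comul : Coid Q →ₐ[ℂ] Osp Q ⊗[ℂ] Coid Q :=
  (AlgEquiv.ofInjective (Coid.incl Q) (Coid.incl_injective Q)).symm.toAlgHom.comp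
    (((Osp.comul Q).comp (Coid Q).val).codRestrict (Coid.incl Q).range (Coid.comul_mem Q))

theorem Coid.incl_comul (y : Coid Q) : Coid.incl Q (Coid.comul Q y) = Osp.comul Q y :=
  congrArg Subtype.val ((AlgEquiv.ofInjective (Coid.incl Q) (Coid.incl_injective Q)).apply_symm_apply
    ⟨Osp.comul Q y, Coid.comul_mem Q y⟩)

/-- The values of the coaction `τ` on the generators `A₋K`, `A₊K`, `K²P`, `Γ^q`. -/
def Coid.coactGen : CoidGen → Osp Q ⊗[ℂ] Coid Q
  | .a => (Osp.k Q ^ 2 * Osp.p Q) ⊗ₜ Coid.gen Q .a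
  | .b => (Osp.ki Q ^ 2 * Osp.p Q) ⊗ₜ Coid.gen Q .b
      + (Q.pow (-1 / 2) * (Q.q - Q.q⁻¹)) • ((Osp.ap Q ^ 2 * Osp.p Q) ⊗ₜ Coid.gen Q .a)
      + (Q.pow (-1 / 2) * (Q.pow (1 / 2) - Q.pow (-1 / 2))) •
          ((Osp.ap Q * Osp.ki Q * Osp.p Q) ⊗ₜ Coid.gen Q .c)
      + (Q.pow (-1 / 2) * (Q.q - Q.q⁻¹)) •
          ((Osp.ap Q * Osp.ki Q * Osp.p Q) ⊗ₜ Coid.gen Q .g)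
  | .c => 1 ⊗ₜ Coid.gen Q .c - (Q.q - Q.q⁻¹) • ((Osp.ap Q * Osp.k Q) ⊗ₜ Coid.gen Q .a)
  | .g => 1 ⊗ₜ Coid.gen Q .g

theorem Coid.isCoid_coactGen : IsCoid Q (Coid.coactGen Q) := by
  have hs := Q.s_ne_zero
  have hs2 := Q.s_two
  have hs4 := Q.s_four
  obtain ⟨h1, h2, h3, h4, h5, h6, h7, h8, h9, h10, h11, h12⟩ := (Osp.isOsp_gen Q).nf
  have a1 := Osp.assoc_rule h1
  have a2 := Osp.assoc_rule h2
  have a3 := Osp.assoc_rule h3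
  have a4 := Osp.assoc_rule h4
  have a5 := Osp.assoc_rule h5
  have a6 := Osp.assoc_rule h6
  have a7 := Osp.assoc_rule h7
  have a8 := Osp.assoc_rule h8
  have a9 := Osp.assoc_rule h9
  have a10 := Osp.assoc_rule h10
  have a11 := Osp.assoc_rule h11
  have a12 := Osp.assoc_rule h12
  obtain ⟨c1, c2, c3, c4, c5, c6, c7⟩ := Coid.isCoid_gen Q
  constructor <;>
  · simp only [coactGen, Osp.ap, Osp.am, Osp.k, Osp.ki, Osp.p, pow_two (Osp.gen _ _),
      Q.pow_neg_half, Q.pow_half, Q.q_eq, Algebra.TensorProduct.one_def,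
      mul_add, add_mul, sub_mul, mul_sub, smul_sub, smul_add, neg_mul, mul_neg,
      Algebra.TensorProduct.tmul_mul_tmul, mul_assoc, smul_mul_assoc, mul_smul_comm,
      TensorProduct.tmul_smul, ← TensorProduct.smul_tmul', smul_smul, TensorProduct.tmul_add,
      TensorProduct.add_tmul, TensorProduct.sub_tmul, TensorProduct.tmul_sub,
      TensorProduct.neg_tmul, TensorProduct.tmul_neg,
      h1, h2, h3, h4, h5, h6, h7, h8, h9, h10, h11, h12,
      a1, a2, a3, a4, a5, a6, a7, a8, a9, a10, a11, a12, one_mul, mul_one,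
      c1, c2, c3, c4, c5, c6, c7]
    try (match_scalars <;> field_simp <;> ring)

/-- The coaction `τ : Coid → osp_q(1|2) ⊗ Coid`, the algebra morphism with the values
`Coid.coactGen` on the generators. -/
def Coid.coact : Coid Q →ₐ[ℂ] Osp Q ⊗[ℂ] Coid Q :=
  Coid.lift (Coid.coactGen Q) (Coid.isCoid_coactGen Q)

theorem Coid.coact_gen (i : CoidGen) : Coid.coact Q (Coid.gen Q i) = Coid.coactGen Q i :=
  Coid.lift_gen _ _ i

/-- The tensor powers of `osp_q(1|2)`, as bundled algebras. -/
def tensorPower : ℕ → AlgCat.{0} ℂ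
  | 0 => AlgCat.of ℂ ℂ
  | n + 1 => AlgCat.of ℂ (tensorPower n ⊗[ℂ] Osp Q)

/-- The `n`-fold tensor product algebra `osp_q(1|2)^{⊗ n}`; one has
`TP Q (n + 1) = TP Q n ⊗ osp_q(1|2)`. -/
abbrev TP (n : ℕ) : Type := tensorPower Q n

/-- `TP Q (n + 1)` is by definition `TP Q n ⊗ osp_q(1|2)`. -/
def TP.succEquiv (n : ℕ) : TP Q (n + 1) ≃ₐ[ℂ] TP Q n ⊗[ℂ] Osp Q := AlgEquiv.refl

/-- `TP Q 0` is by definition `ℂ`. -/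
def TP.zeroEquiv : TP Q 0 ≃ₐ[ℂ] ℂ := AlgEquiv.refl

/-- The morphism `1 ⊗ ... ⊗ 1 ⊗ f` (with `n` units), for `f` the coproduct or the coaction `τ`. -/
def extLast (f : Coid Q →ₐ[ℂ] Osp Q ⊗[ℂ] Coid Q) (n : ℕ) :
    TP Q n ⊗[ℂ] Coid Q →ₐ[ℂ] TP Q (n + 1) ⊗[ℂ] Coid Q :=
  (Algebra.TensorProduct.map (TP.succEquiv Q n).symm.toAlgHom (AlgHom.id ℂ (Coid Q))).comp
    ((Algebra.TensorProduct.assoc ℂ ℂ ℂ (TP Q n) (Osp Q) (Coid Q)).symm.toAlgHom.comp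
      (Algebra.TensorProduct.map (AlgHom.id ℂ (TP Q n)) f))

/-- The morphism `1 ⊗ ... ⊗ 1 ⊗ Δ ⊗ 1` (with `n` units on the left). -/
def extMid (n : ℕ) :
    TP Q (n + 1) ⊗[ℂ] Coid Q →ₐ[ℂ] TP Q (n + 2) ⊗[ℂ] Coid Q :=
  Algebra.TensorProduct.map
    ((TP.succEquiv Q (n + 1)).symm.toAlgHom.comp
      ((Algebra.TensorProduct.map (TP.succEquiv Q n).symm.toAlgHom (AlgHom.id ℂ (Osp Q))).comp
        ((Algebra.TensorProduct.assoc ℂ ℂ ℂ (TP Q n) (Osp Q) (Osp Q)).symm.toAlgHom.comp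
          ((Algebra.TensorProduct.map (AlgHom.id ℂ (TP Q n)) (Osp.comul Q)).comp
            (TP.succEquiv Q n).toAlgHom))))
    (AlgHom.id ℂ (Coid Q))


/-- The extension procedure, for a set `A` of tensor positions, which are numbered from `0`.
The process starts at position `min A` with `1 ⊗ ... ⊗ 1 ⊗ Γ^q`, and `extend Q A k` is the state
after it has reached the position `k ≥ min A`, with the last tensor factor in `Coid`:
* for `k ∈ A` it is the first component, an element of the tensor power with positions `0, ..., k`;
* for `k ∉ A` a hole is open and the state is the second component, an element of the tensor power
  with positions `0, ..., k + 1`.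
The component that does not apply carries no meaning. -/
def extend (A : Finset ℕ) : (k : ℕ) → (TP Q k ⊗[ℂ] Coid Q) × (TP Q (k + 1) ⊗[ℂ] Coid Q)
  | 0 => (1 ⊗ₜ Coid.gen Q .g, 0)
  | k + 1 =>
    (if ∀ i ∈ A, k < i then 1 ⊗ₜ Coid.gen Q .g
      else if k ∈ A then extLast Q (Coid.comul Q) k (extend A k).1
      else (extend A k).2,
     if k ∈ A then extLast Q (Coid.coact Q) (k + 1) (extLast Q (Coid.comul Q) k (extend A k).1)
      else extMid Q k (extend A k).2)

/-- The element `Γ_A^q` of `osp_q(1|2)^{⊗ n}`, for a set `A ⊆ {0, ..., n - 1}` of positions. -/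
def gamma (A : Finset ℕ) : (n : ℕ) → TP Q n
  | 0 => algebraMap ℂ (TP Q 0) (-Q.num (1 / 2))
  | n + 1 =>
    if n ∈ A then (TP.succEquiv Q n).symm
      (Algebra.TensorProduct.map (AlgHom.id ℂ (TP Q n)) (Coid Q).val (extend Q A n).1)
    else (TP.succEquiv Q n).symm (gamma A n ⊗ₜ 1)

/-- The `q`-deformed Bannai-Ito algebra `𝒜_n^q`. -/
def qBannaiIto (n : ℕ) : Subalgebra ℂ (TP Q n) :=
  Algebra.adjoin ℂ {x | ∃ A ⊆ Finset.range n, x = gamma Q A n}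

section Model

variable {n : ℕ}

/-- `f ↦ f(x_1, ..., c x_i, ..., x_n)`. -/
def scaleVar (c : ℂ) (i : Fin n) : Module.End ℂ (MvPolynomial (Fin n) ℂ) :=
  (MvPolynomial.aeval (Function.update MvPolynomial.X i
    (MvPolynomial.C c * MvPolynomial.X i))).toLinearMap

/-- The `q`-shift operator `T_{q,i}`. -/
def qShift (i : Fin n) : Module.End ℂ (MvPolynomial (Fin n) ℂ) := scaleVar Q.q i

/-- `T_{q,i}⁻¹`. -/
def qShiftInv (i : Fin n) : Module.End ℂ (MvPolynomial (Fin n) ℂ) := scaleVar Q.q⁻¹ i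

/-- `T_{q,i}^(1/2)`. -/
def qShiftHalf (i : Fin n) : Module.End ℂ (MvPolynomial (Fin n) ℂ) := scaleVar (Q.pow (1 / 2)) i

/-- `T_{q,i}^(-1/2)`. -/
def qShiftNegHalf (i : Fin n) : Module.End ℂ (MvPolynomial (Fin n) ℂ) :=
  scaleVar (Q.pow (-1 / 2)) i

/-- The reflection `r_i`. -/
def reflection (i : Fin n) : Module.End ℂ (MvPolynomial (Fin n) ℂ) := scaleVar (-1) i

/-- Multiplication by the variable `x_i`. -/
def mulVar (i : Fin n) : Module.End ℂ (MvPolynomial (Fin n) ℂ) :=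
  LinearMap.mulLeft ℂ (MvPolynomial.X i)

/-- Division by the variable `x_i`; monomials not divisible by `x_i` are sent to `0`. -/
def divVar (i : Fin n) : Module.End ℂ (MvPolynomial (Fin n) ℂ) where
  toFun f := f.divMonomial (Finsupp.single i 1)
  map_add' f g := MvPolynomial.add_divMonomial f g _
  map_smul' r f := by
    ext v
    simp [MvPolynomial.coeff_divMonomial]

/-- The `q`-Dunkl operator `D_i^q`. -/
def qDunkl (μ : Fin n → ℝ) (i : Fin n) : Module.End ℂ (MvPolynomial (Fin n) ℂ) :=
  (Q.pow (μ i) / (Q.q - Q.q⁻¹)) • (divVar i * (qShift Q i - reflection i))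
    - (Q.pow (-μ i) / (Q.q - Q.q⁻¹)) • (divVar i * (qShiftInv Q i - reflection i))

/-- `γ_i = μ_i + 1/2`. -/
def gammaParam (μ : Fin n → ℝ) (i : Fin n) : ℂ := μ i + 1 / 2

/-- The operator `R_{[n],i}^q`. -/
def qR (μ : Fin n → ℝ) (i : Fin n) : Module.End ℂ (MvPolynomial (Fin n) ℂ) :=
  (((List.finRange n).filter (· < i)).map fun j =>
      Q.pow (-gammaParam μ j / 2) • qShiftNegHalf Q j).prod
    * (((List.finRange n).filter (i < ·)).map fun j =>
      Q.pow (gammaParam μ j / 2) • (qShiftHalf Q j * reflection j)).prod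

/-- The `ℤ₂ⁿ` `q`-Dirac-Dunkl operator `D_{[n]}^q`. -/
def qDiracDunkl (μ : Fin n → ℝ) : Module.End ℂ (MvPolynomial (Fin n) ℂ) :=
  ∑ i, qDunkl Q μ i * qR Q μ i

/-- The position operator `X_{[n]}^q`. -/
def qPosition (μ : Fin n → ℝ) : Module.End ℂ (MvPolynomial (Fin n) ℂ) :=
  ∑ i, mulVar i * qR Q μ i

/-- The realization of the generators of `osp_q(1|2)` in the variable `x_i`:
`A₊ ↦ x_i`, `A₋ ↦ D_i^q`, `K ↦ q^(γ_i/2) T_{q,i}^(1/2)`, `P ↦ r_i`. -/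
def modelGen (μ : Fin n → ℝ) (i : Fin n) : OspGen → Module.End ℂ (MvPolynomial (Fin n) ℂ)
  | .ap => mulVar i
  | .am => qDunkl Q μ i
  | .k => Q.pow (gammaParam μ i / 2) • qShiftHalf Q i
  | .ki => Q.pow (-gammaParam μ i / 2) • qShiftNegHalf Q i
  | .p => reflection i

theorem scaleVar_monomial (c : ℂ) (i : Fin n) (v : Fin n →₀ ℕ) (a : ℂ) :
    scaleVar c i (MvPolynomial.monomial v a) = MvPolynomial.monomial v (c ^ v i * a) := by
  classical
  have h : (v.prod fun j e => (Function.update MvPolynomial.X i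
      (MvPolynomial.C c * MvPolynomial.X i) j : MvPolynomial (Fin n) ℂ) ^ e)
      = MvPolynomial.C (c ^ v i) * v.prod fun j e => (MvPolynomial.X j) ^ e := by
    have : (fun (j : Fin n) (e : ℕ) => (Function.update MvPolynomial.X i
      (MvPolynomial.C c * MvPolynomial.X i) j : MvPolynomial (Fin n) ℂ) ^ e)
      = fun j e => (if j = i then MvPolynomial.C c else 1) ^ e * (MvPolynomial.X j) ^ e := by
      ext1 j
      ext1 e
      by_cases hj : j = i
      · subst hj; simp [mul_pow]
      · simp [hj]
    rw [this, Finsupp.prod_mul]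
    congr 1
    rw [Finsupp.prod_fintype _ _ (by simp), Finset.prod_eq_single i]
    · simp
    · intro j _ hj
      simp [hj]
    · simp
  simp only [scaleVar, AlgHom.toLinearMap_apply, MvPolynomial.aeval_monomial]
  rw [h, MvPolynomial.monomial_eq (s := v), MvPolynomial.algebraMap_eq, ← mul_assoc,
    ← MvPolynomial.C_mul, mul_comm a]

theorem mulVar_monomial (i : Fin n) (v : Fin n →₀ ℕ) (a : ℂ) :
    mulVar i (MvPolynomial.monomial v a) = MvPolynomial.monomial (v.update i (v i + 1)) a := by
  have : v.update i (v i + 1) = Finsupp.single i 1 + v := by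
    ext j
    by_cases hj : j = i
    · subst hj; simp [add_comm]
    · simp [hj, Finsupp.single_apply, Ne.symm hj]
  rw [this, mulVar, LinearMap.mulLeft_apply, MvPolynomial.X, MvPolynomial.monomial_mul, one_mul]

theorem divVar_monomial (i : Fin n) (v : Fin n →₀ ℕ) (a : ℂ) (h : v i ≠ 0) :
    divVar i (MvPolynomial.monomial v a) = MvPolynomial.monomial (v.update i (v i - 1)) a := by
  obtain ⟨m, hm⟩ := Nat.exists_eq_succ_of_ne_zero h
  have : v = Finsupp.single i 1 + v.update i (v i - 1) := by
    ext j
    by_cases hj : j = i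
    · subst hj; simp; omega
    · simp [hj, Finsupp.single_apply, Ne.symm hj]
  conv_lhs => rw [this]
  have h2 := MvPolynomial.divMonomial_monomial_mul (Finsupp.single i 1)
    (MvPolynomial.monomial (v.update i (v i - 1)) a)
  rw [MvPolynomial.monomial_mul, one_mul] at h2
  exact h2

/-- The coefficients of `D_i^q` on powers of `x_i`. -/
def dunklCoeff (μ : ℂ) (m : ℕ) : ℂ :=
  (Q.pow μ * (Q.q ^ m - (-1) ^ m) - Q.pow (-μ) * ((Q.q⁻¹) ^ m - (-1) ^ m)) / (Q.q - Q.q⁻¹)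

theorem qDunkl_monomial (μ : Fin n → ℝ) (i : Fin n) (v : Fin n →₀ ℕ) (a : ℂ) :
    qDunkl Q μ i (MvPolynomial.monomial v a)
      = MvPolynomial.monomial (v.update i (v i - 1)) (dunklCoeff Q (μ i) (v i) * a) := by
  have key : ∀ c : ℂ, (divVar i * (scaleVar c i - reflection i)) (MvPolynomial.monomial v a)
      = MvPolynomial.monomial (v.update i (v i - 1)) ((c ^ v i - (-1) ^ v i) * a) := by
    intro c
    rw [Module.End.mul_apply, LinearMap.sub_apply, reflection, scaleVar_monomial,
      scaleVar_monomial, ← map_sub, ← sub_mul]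
    by_cases h : v i = 0
    · simp [h]
    · exact divVar_monomial i v _ h
  rw [qDunkl, LinearMap.sub_apply, LinearMap.smul_apply, LinearMap.smul_apply, qShift, qShiftInv,
    key, key, MvPolynomial.smul_monomial, MvPolynomial.smul_monomial, ← map_sub]
  congr 1
  simp only [smul_eq_mul, dunklCoeff]
  ring

/-- The effect of the realized generators on exponents. -/
def modelExp : OspGen → ℕ → ℕ
  | .ap, m => m + 1
  | .am, m => m - 1
  | _, m => m

/-- The effect of the realized generators on coefficients. -/
def modelCoeff (μ : ℂ) : OspGen → ℕ → ℂ
  | .ap, _ => 1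
  | .am, m => dunklCoeff Q μ m
  | .k, m => Q.pow ((μ + 1 / 2) / 2) * Q.s ^ m
  | .ki, m => (Q.pow ((μ + 1 / 2) / 2))⁻¹ * ((Q.s)⁻¹) ^ m
  | .p, m => (-1) ^ m

theorem modelGen_monomial (μ : Fin n → ℝ) (i : Fin n) (y : OspGen) (v : Fin n →₀ ℕ) (a : ℂ) :
    modelGen Q μ i y (MvPolynomial.monomial v a)
      = MvPolynomial.monomial (v.update i (modelExp y (v i)))
          (modelCoeff Q (μ i) y (v i) * a) := by
  have hu : v.update i (v i) = v := by simp
  cases y with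
  | ap => simp [modelGen, modelExp, modelCoeff, mulVar_monomial]
  | am => exact qDunkl_monomial Q μ i v a
  | k => simp [modelGen, modelExp, modelCoeff, qShiftHalf, scaleVar_monomial, gammaParam,
      MvPolynomial.smul_monomial, ← Q.pow_half, mul_assoc]
  | ki =>
    have hk : Q.pow (-gammaParam μ i / 2) = (Q.pow ((μ i + 1 / 2) / 2))⁻¹ := by
      rw [neg_div, Q.pow_neg, gammaParam]
    simp only [modelGen, modelExp, modelCoeff, qShiftNegHalf, scaleVar_monomial, hk, hu,
      MvPolynomial.smul_monomial, ← Q.pow_neg_half, mul_assoc, smul_eq_mul, LinearMap.smul_apply]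
  | p => simp [modelGen, modelExp, modelCoeff, reflection, scaleVar_monomial]

theorem isOsp_modelGen (μ : Fin n → ℝ) (i : Fin n) : IsOsp Q (modelGen Q μ i) := by
  have hs := Q.s_ne_zero
  have hs2 := Q.s_two
  have hs4 := Q.s_four
  have hsub : Q.s ^ 2 + 1 ≠ 0 := by
    intro h
    apply hs4
    linear_combination (Q.s ^ 2 - 1) * h
  have hg := Q.pow_ne_zero ((μ i + 1 / 2) / 2 : ℂ)
  have hμ : Q.pow (μ i : ℂ) = Q.pow ((μ i + 1 / 2) / 2 : ℂ) ^ 2 * (Q.s)⁻¹ := by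
    rw [← Q.pow_half, ← Q.pow_neg, sq, ← Q.pow_add, ← Q.pow_add]
    congr 1
    ring
  have h0 : dunklCoeff Q (μ i) 0 = 0 := by simp [dunklCoeff]
  have hd : ∀ m, dunklCoeff Q (μ i) m
      = (Q.pow ((μ i + 1 / 2) / 2 : ℂ) ^ 2 * (Q.s)⁻¹ * (Q.s ^ m * Q.s ^ m - (-1) ^ m)
        - (Q.pow ((μ i + 1 / 2) / 2 : ℂ) ^ 2 * (Q.s)⁻¹)⁻¹ * ((Q.s ^ m * Q.s ^ m)⁻¹ - (-1) ^ m))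
        / (Q.s ^ 2 - (Q.s ^ 2)⁻¹) := by
    intro m
    rw [dunklCoeff, Q.pow_neg, hμ, Q.q_eq, inv_pow, ← pow_mul, mul_comm 2 m, pow_mul, sq (Q.s ^ m)]
  generalize hG : Q.pow ((μ i + 1 / 2) / 2 : ℂ) = G at *
  have hS : ∀ m : ℕ, Q.s ^ m ≠ 0 := fun m => pow_ne_zero m hs
  have hsq : ∀ m : ℕ, ((-1 : ℂ) ^ m) * (-1) ^ m = 1 := fun m => by rw [← mul_pow]; norm_num
  constructor <;> refine MvPolynomial.linearMap_ext fun v => LinearMap.ext fun a => ?_ <;>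
    simp only [LinearMap.comp_apply, Module.End.mul_apply, LinearMap.smul_apply,
      LinearMap.add_apply, LinearMap.sub_apply, pow_two (_ : Module.End ℂ _), modelGen_monomial,
      MvPolynomial.smul_monomial, smul_eq_mul, Finsupp.coe_update, Function.update_self,
      Finsupp.update_idem, modelExp, modelCoeff, ← map_add, ← map_sub, LinearMap.zero_apply,
      Module.End.one_apply, Q.pow_half, Q.pow_neg_half, hG, inv_pow, Finsupp.update_self] <;>
    have h1 := hS (v i) <;> have h2 := hsq (v i)
  · congr 1
    rw [pow_succ]
    field_simp
  · rcases hv : v i with _ | m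
    · simp [h0]
    · have h3 := hS m
      congr 1
      rw [Nat.add_sub_cancel, pow_succ]
      field_simp
  · have h3 : MvPolynomial.monomial (v.update i (v i - 1 + 1)) (1 * (dunklCoeff Q (μ i) (v i) * a))
        = MvPolynomial.monomial v (dunklCoeff Q (μ i) (v i) * a) := by
      rcases hv : v i with _ | m
      · simp [h0]
      · rw [Nat.add_sub_cancel, ← hv, Finsupp.update_self, one_mul]
    rw [h3, Nat.add_sub_cancel, Finsupp.update_self, ← map_add]
    congr 1
    rw [hd, hd, pow_succ, pow_succ]
    field_simp
    ring
  · rw [pow_succ]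
    simp
  · rcases hv : v i with _ | m
    · simp [h0]
    · rw [Nat.add_sub_cancel, pow_succ]
      rw [show (-1 : ℂ) ^ m * (dunklCoeff Q (μ i) (m + 1) * a)
        + dunklCoeff Q (μ i) (m + 1) * ((-1) ^ m * -1 * a) = 0 by ring, map_zero]
  · congr 1
    ring
  · congr 1
    ring
  · congr 1
    field_simp
  · congr 1
    field_simp
  · congr 1
    linear_combination a * h2

end Model

theorem commute_modelGen {n : ℕ} (μ : Fin n → ℝ) {i j : Fin n} (hij : i ≠ j) (y z : OspGen) :
    Commute (modelGen Q μ i y) (modelGen Q μ j z) := by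
  classical
  refine MvPolynomial.linearMap_ext fun v => LinearMap.ext fun a => ?_
  simp only [LinearMap.comp_apply, Module.End.mul_apply, modelGen_monomial, Finsupp.coe_update,
    Function.update_of_ne hij, Function.update_of_ne hij.symm]
  rw [Finsupp.update_comm v hij, mul_left_comm]

/-- Commutation with an algebra morphism on `osp_q(1|2)` can be checked on the generators. -/
theorem Osp.commute_of_gen {E : Type*} [Ring E] [Algebra ℂ E] (ρ : Osp Q →ₐ[ℂ] E) (e : E)
    (h : ∀ y, Commute e (ρ (Osp.gen Q y))) (u : Osp Q) : Commute e (ρ u) := by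
  let π : FreeAlgebra ℂ OspGen →ₐ[ℂ] Osp Q := RingQuot.mkAlgHom ℂ (OspRel Q)
  have hπ : ∀ w, Commute e ((ρ.comp π) w) := by
    intro w
    induction w using FreeAlgebra.induction with
    | grade0 r => rw [AlgHom.commutes]; exact (Algebra.commutes r e).symm
    | grade1 y => exact h y
    | mul a b ha hb => rw [map_mul]; exact ha.mul_right hb
    | add a b ha hb => rw [map_add]; exact ha.add_right hb
  obtain ⟨w, rfl⟩ := RingQuot.mkAlgHom_surjective ℂ (OspRel Q) u
  exact hπ w

/-- The realization of `osp_q(1|2)` in the variable `x_i`. -/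
def modelVar {n : ℕ} (μ : Fin n → ℝ) (i : Fin n) :
    Osp Q →ₐ[ℂ] Module.End ℂ (MvPolynomial (Fin n) ℂ) :=
  Osp.lift (modelGen Q μ i) (isOsp_modelGen Q μ i)

theorem commute_modelVar {n : ℕ} (μ : Fin n → ℝ) {i j : Fin n} (hij : i ≠ j) (u v : Osp Q) :
    Commute (modelVar Q μ i u) (modelVar Q μ j v) := by
  refine Osp.commute_of_gen Q _ _ (fun z => Commute.symm ?_) v
  refine Osp.commute_of_gen Q _ _ (fun y => ?_) u
  rw [modelVar, modelVar, Osp.lift_gen, Osp.lift_gen]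
  exact commute_modelGen Q μ hij.symm z y

variable {Q}

/-- The algebra morphism `u₁ ⊗ ... ⊗ u_k ↦ ρ₁(u₁) ⋯ ρ_k(u_k)` defined by morphisms `ρ₁, ..., ρ_k`
with commuting images, together with the fact that elements commuting with all these images
commute with all its values. -/
def TP.liftAux {E : Type} [Ring E] [Algebra ℂ E] : (k : ℕ) → (ρ : Fin k → Osp Q →ₐ[ℂ] E) →
    (∀ i j, i ≠ j → ∀ u v, Commute (ρ i u) (ρ j v)) →
    {φ : TP Q k →ₐ[ℂ] E // ∀ e, (∀ i u, Commute e (ρ i u)) → ∀ t, Commute e (φ t)}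
  | 0, _, _ => ⟨(Algebra.ofId ℂ E).comp (TP.zeroEquiv Q).toAlgHom,
      fun e _ t => (Algebra.commutes (TP.zeroEquiv Q t) e).symm⟩
  | k + 1, ρ, h =>
    let r := TP.liftAux k (fun i => ρ i.castSucc)
      (fun i j hij => h _ _ fun h' => hij (Fin.castSucc_injective k h'))
    have hr : ∀ t u, Commute (r.1 t) (ρ (Fin.last k) u) := fun t u =>
      (r.2 _ (fun i v => h _ _ (Fin.castSucc_lt_last i).ne' u v) t).symm
    ⟨(Algebra.TensorProduct.lift r.1 (ρ (Fin.last k)) hr).comp (TP.succEquiv Q k).toAlgHom,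
      fun e he t => by
        change Commute e (Algebra.TensorProduct.lift r.1 (ρ (Fin.last k)) hr (TP.succEquiv Q k t))
        induction TP.succEquiv Q k t using TensorProduct.induction_on with
        | zero => rw [map_zero]; exact Commute.zero_right e
        | tmul x y =>
          rw [Algebra.TensorProduct.lift_tmul]
          exact (r.2 e (fun i u => he _ u) x).mul_right (he _ y)
        | add x y hx hy => rw [map_add]; exact hx.add_right hy⟩

variable (Q)

/-- The realization of `osp_q(1|2)^{⊗ n}` by operators on polynomials in `n` variables, in which
the `i`-th tensor factor acts on the variable `x_i`. -/
def model {n : ℕ} (μ : Fin n → ℝ) : TP Q n →ₐ[ℂ] Module.End ℂ (MvPolynomial (Fin n) ℂ) :=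
  (TP.liftAux n (modelVar Q μ) (fun _ _ hij => commute_modelVar Q μ hij)).1

end QDunkl

end

/-! The operators `qDiracDunkl` and `qPosition` are the images under `model` of the n-fold iterated
coproducts of A₋ and A₊: these are the sums over i of K⁻¹ ⊗ ... ⊗ K⁻¹ ⊗ A± ⊗ KP ⊗ ... ⊗ KP with A±
in position i, and the factors other than A± give the operator R_{[n],i} (`TP.liftAux_comul`). It
therefore suffices that Γ_A commutes with the iterated coproduct of every element of osp_q(1|2), a
statement inside the tensor power (`commute_gamma`). It is proved along the construction of Γ_A:
each state X of the extension procedure is `Coid.Invariant`, that is, it commutes with all iterated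
coproducts of the right length. The initial state is invariant because Γ^q is central, and the steps
that apply Δ preserve invariance by coassociativity.

The substance is the step that applies τ (`Coid.commute_coact`). Let δ be the iterated coproduct
into B and suppose that X in B ⊗ Coid commutes with every (δ ⊗ 1)Δ(u). One wants (1 ⊗ τ)X to commute
with (1 ⊗ Δ)(δ ⊗ 1)Δ(u). Write c = K²P and let y be A₋K or A₊K. The grouplike K, P and c are easy: K
⊗ K, for instance, moves past the values of τ with the same scalars with which K moves past Coid,
and such a rescaling is all that the commutation of X records (`commute_of_twist`).

For y, the element (δ ⊗ 1)Δ(y) = δ(y) ⊗ c + 1 ⊗ y lies in B ⊗ Coid, so its image δ(y) ⊗ τ(c) + 1 ⊗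
τ(y) commutes with (1 ⊗ τ)X; the element that matters is however T = δ(y) ⊗ c ⊗ c + 1 ⊗ Δ(y). Since
τ(c) commutes with c ⊗ c, multiplying T by δ(c) ⊗ τ(c), and the former element by δ(c) ⊗ c ⊗ c,
gives products that differ only by δ(c) ⊗ (τ(c)Δ(y) - (c ⊗ c)τ(y)). This `Coid.obstruction` moves
past the values of τ with the same scalars as c does past Coid (`Coid.obstruction_a_mul`,
`Coid.obstruction_b_mul`), so the twisting argument covers it as well. Hence (δ(c) ⊗ τ(c))T commutes
with (1 ⊗ τ)X. So does δ(c) ⊗ τ(c), and this factor can be cancelled: up to units τ(c) is 1 - m with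
m of degree -1 in the last factor, and m z = z forces z = 0 (`Coid.coactOsp_c_regular`). Finally A±
= (A±K)K⁻¹. -/

noncomputable section

namespace QDunkl

variable (Q : QDeformation)

/-! ### Rescaling automorphisms and intertwiners of the coideal subalgebra. -/

/-- The relations of the coideal subalgebra are homogeneous: rescaling `a` and `b` by mutually
inverse scalars preserves them. -/
theorem IsCoid.rescale {Q} {R : Type*} [Ring R] [Algebra ℂ R] {x : CoidGen → R} (hx : IsCoid Q x)
    {χ : CoidGen → ℂ} (hab : χ .a * χ .b = 1) (hc : χ .c = 1) (hg : χ .g = 1) :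
    IsCoid Q (fun i => χ i • x i) := by
  have hba : χ .b * χ .a = 1 := by rw [mul_comm, hab]
  constructor <;> simp only [hc, hg, one_smul, smul_mul_assoc, mul_smul_comm, smul_smul, hab, hba]
  · rw [hx.ca, smul_smul, mul_comm]
  · rw [hx.cb, smul_smul, mul_comm]
  · rw [hx.ga]
  · rw [hx.gb]
  · rw [hx.gc]
  · exact hx.ba
  · exact hx.ab

theorem Coid.lift_gen_surjective :
    Function.Surjective (FreeAlgebra.lift ℂ (Coid.gen Q)) := by
  intro y
  obtain ⟨u, hu⟩ := Coid.exists_free Q y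
  refine ⟨u, Subtype.ext ?_⟩
  rw [← hu]
  have : (Coid Q).val.comp (FreeAlgebra.lift ℂ (Coid.gen Q))
      = FreeAlgebra.lift ℂ (Osp.coidGen Q) := by
    ext i; simp [Coid.gen]
  exact DFunLike.congr_fun this u

variable {Q} in
/-- An intertwining relation between two algebra morphisms on `Coid` can be checked on the
generators. -/
theorem Coid.intertwine {R : Type*} [Ring R] [Algebra ℂ R] {f g : Coid Q →ₐ[ℂ] R} {w : R}
    (h : ∀ i, w * f (Coid.gen Q i) = g (Coid.gen Q i) * w) (y : Coid Q) :
    w * f y = g y * w := by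
  obtain ⟨u, rfl⟩ := Coid.lift_gen_surjective Q y
  induction u using FreeAlgebra.induction with
  | grade0 r => simp only [AlgHom.commutes]; exact (Algebra.commutes r w).symm
  | grade1 i => simpa using h i
  | mul a b ha hb => rw [map_mul, map_mul, map_mul, ← mul_assoc, ha, mul_assoc, hb, mul_assoc]
  | add a b ha hb => rw [map_add, map_add, map_add, mul_add, ha, hb, add_mul]

/-! ### The obstruction between τ and the coproduct. -/

/-- The coaction `τ` with values in `osp_q(1|2) ⊗ osp_q(1|2)`. -/
def Coid.coactOsp : Coid Q →ₐ[ℂ] Osp Q ⊗[ℂ] Osp Q := (Coid.incl Q).comp (Coid.coact Q)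

/-- The element `τ(K²P) Δ(A₋K) - (K²P ⊗ K²P) τ(A₋K)`, resp. the same with `A₊`. -/
def Coid.obstruction (i : CoidGen) : Osp Q ⊗[ℂ] Coid Q :=
  Coid.coactGen Q .c * Coid.comulGen Q i - (Osp.coidGen Q .c ⊗ₜ Coid.gen Q .c) * Coid.coactGen Q i

/-- The scalars by which `K²P` commutes with the generators of `Coid`. -/
def Coid.weightC : CoidGen → ℂ
  | .a => -(Q.s ^ 2)⁻¹
  | .b => -Q.s ^ 2
  | _ => 1

-- This makes the obstruction usable: it moves past τ(Coid) exactly as K²P moves past Coid, although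
-- it is not invertible. Keeping the second factor in `Coid` lets the seven relations of `IsCoid`
-- bring both sides to normal order, after which coefficients are compared.
set_option maxHeartbeats 8000000 in
theorem Coid.obstruction_a_mul (j : CoidGen) :
    Coid.obstruction Q .a * Coid.coactGen Q j
      = Coid.weightC Q j • (Coid.coactGen Q j * Coid.obstruction Q .a) := by
  have hs := Q.s_ne_zero
  have hs2 := Q.s_two
  have hs4 := Q.s_four
  obtain ⟨h1, h2, h3, h4, h5, h6, h7, h8, h9, h10, h11, h12⟩ := (Osp.isOsp_gen Q).nf
  have a1 := Osp.assoc_rule h1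
  have a2 := Osp.assoc_rule h2
  have a3 := Osp.assoc_rule h3
  have a4 := Osp.assoc_rule h4
  have a5 := Osp.assoc_rule h5
  have a6 := Osp.assoc_rule h6
  have a7 := Osp.assoc_rule h7
  have a8 := Osp.assoc_rule h8
  have a9 := Osp.assoc_rule h9
  have a10 := Osp.assoc_rule h10
  have a11 := Osp.assoc_rule h11
  have a12 := Osp.assoc_rule h12
  obtain ⟨c1, c2, c3, c4, c5, c6, c7⟩ := Coid.isCoid_gen Q
  have d1 := Osp.assoc_rule c1
  have d2 := Osp.assoc_rule c2
  have d3 := Osp.assoc_rule c3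
  have d4 := Osp.assoc_rule c4
  have d5 := Osp.assoc_rule c5
  have d6 := Osp.assoc_rule c6
  have d7 := Osp.assoc_rule c7
  cases j <;>
  · simp only [obstruction, weightC, comulGen, Osp.coidGen, coactGen, Osp.ap, Osp.am, Osp.k,
      Osp.ki, Osp.p, pow_two (Osp.gen _ _), Q.pow_neg_half, Q.pow_half, Q.q_eq,
      Algebra.TensorProduct.one_def,
      mul_add, add_mul, sub_mul, mul_sub, smul_sub, smul_add, neg_mul, mul_neg,
      Algebra.TensorProduct.tmul_mul_tmul, mul_assoc, smul_mul_assoc, mul_smul_comm,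
      TensorProduct.tmul_smul, ← TensorProduct.smul_tmul', smul_smul, TensorProduct.tmul_add,
      TensorProduct.add_tmul, TensorProduct.sub_tmul, TensorProduct.tmul_sub,
      TensorProduct.neg_tmul, TensorProduct.tmul_neg,
      h1, h2, h3, h4, h5, h6, h7, h8, h9, h10, h11, h12,
      a1, a2, a3, a4, a5, a6, a7, a8, a9, a10, a11, a12, one_mul, mul_one,
      c1, c2, c3, c4, c5, c6, c7, d1, d2, d3, d4, d5, d6, d7]
    try (match_scalars <;> field_simp <;> ring)

set_option maxHeartbeats 8000000 in
theorem Coid.obstruction_b_mul (j : CoidGen) :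
    Coid.obstruction Q .b * Coid.coactGen Q j
      = Coid.weightC Q j • (Coid.coactGen Q j * Coid.obstruction Q .b) := by
  have hs := Q.s_ne_zero
  have hs2 := Q.s_two
  have hs4 := Q.s_four
  obtain ⟨h1, h2, h3, h4, h5, h6, h7, h8, h9, h10, h11, h12⟩ := (Osp.isOsp_gen Q).nf
  have a1 := Osp.assoc_rule h1
  have a2 := Osp.assoc_rule h2
  have a3 := Osp.assoc_rule h3
  have a4 := Osp.assoc_rule h4
  have a5 := Osp.assoc_rule h5
  have a6 := Osp.assoc_rule h6
  have a7 := Osp.assoc_rule h7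
  have a8 := Osp.assoc_rule h8
  have a9 := Osp.assoc_rule h9
  have a10 := Osp.assoc_rule h10
  have a11 := Osp.assoc_rule h11
  have a12 := Osp.assoc_rule h12
  obtain ⟨c1, c2, c3, c4, c5, c6, c7⟩ := Coid.isCoid_gen Q
  have d1 := Osp.assoc_rule c1
  have d2 := Osp.assoc_rule c2
  have d3 := Osp.assoc_rule c3
  have d4 := Osp.assoc_rule c4
  have d5 := Osp.assoc_rule c5
  have d6 := Osp.assoc_rule c6
  have d7 := Osp.assoc_rule c7
  cases j <;>
  · simp only [obstruction, weightC, comulGen, Osp.coidGen, coactGen, Osp.ap, Osp.am, Osp.k,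
      Osp.ki, Osp.p, pow_two (Osp.gen _ _), Q.pow_neg_half, Q.pow_half, Q.q_eq,
      Algebra.TensorProduct.one_def,
      mul_add, add_mul, sub_mul, mul_sub, smul_sub, smul_add, neg_mul, mul_neg,
      Algebra.TensorProduct.tmul_mul_tmul, mul_assoc, smul_mul_assoc, mul_smul_comm,
      TensorProduct.tmul_smul, ← TensorProduct.smul_tmul', smul_smul, TensorProduct.tmul_add,
      TensorProduct.add_tmul, TensorProduct.sub_tmul, TensorProduct.tmul_sub,
      TensorProduct.neg_tmul, TensorProduct.tmul_neg,
      h1, h2, h3, h4, h5, h6, h7, h8, h9, h10, h11, h12,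
      a1, a2, a3, a4, a5, a6, a7, a8, a9, a10, a11, a12, one_mul, mul_one,
      c1, c2, c3, c4, c5, c6, c7, d1, d2, d3, d4, d5, d6, d7]
    try (match_scalars <;> field_simp <;> ring)

/-! ### The ℤ-grading by the last tensor factor. -/

/-- The degrees of the generators in the `ℤ`-grading of `osp_q(1|2)`. -/
def OspGen.degree : OspGen → ℤ
  | .ap => 1
  | .am => -1
  | _ => 0

-- The defining relations are homogeneous when A₊ and A₋ have degrees 1 and -1, so the generators
-- multiplied by the corresponding powers of a central variable satisfy them again. This yields the
-- grading as a morphism into Laurent polynomials.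
variable {Q} in
theorem IsOsp.single {R : Type*} [Ring R] [Algebra ℂ R] {x : OspGen → R} (hx : IsOsp Q x) :
    IsOsp Q (fun i => AddMonoidAlgebra.single (OspGen.degree i) (x i)) := by
  have s_sub : ∀ u v : R, (AddMonoidAlgebra.single (0 : ℤ) (u - v) : AddMonoidAlgebra R ℤ)
      = AddMonoidAlgebra.single 0 u - AddMonoidAlgebra.single 0 v := fun u v => by
    rw [sub_eq_add_neg, sub_eq_add_neg, AddMonoidAlgebra.single_add, AddMonoidAlgebra.single_neg]
  have h1 := hx.ap_am
  have h2 := hx.p_p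
  rw [pow_two, pow_two] at h1
  rw [pow_two] at h2
  constructor <;>
  · simp only [OspGen.degree, AddMonoidAlgebra.single_mul_single, pow_two,
      AddMonoidAlgebra.smul_single, ← AddMonoidAlgebra.single_add, ← s_sub, add_zero, zero_add,
      add_neg_cancel, neg_add_cancel, AddMonoidAlgebra.one_def, hx.k_ap, hx.k_am, h1,
      hx.p_ap, hx.p_am, hx.p_k, hx.p_ki, hx.k_ki, hx.ki_k, h2,
      AddMonoidAlgebra.single_zero]

variable {Q} in
theorem IsOsp.map {R S : Type*} [Ring R] [Algebra ℂ R] [Ring S] [Algebra ℂ S] {x : OspGen → R}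
    (hx : IsOsp Q x) (f : R →ₐ[ℂ] S) : IsOsp Q (fun i => f (x i)) := by
  constructor <;>
  · simp only [← map_mul, ← map_pow, ← map_add, ← map_sub, ← map_smul, hx.k_ap, hx.k_am, hx.ap_am,
      hx.p_ap, hx.p_am, hx.p_k, hx.p_ki, hx.k_ki, hx.ki_k, hx.p_p, map_zero, map_one]

section Grading

variable (B : Type) [Ring B] [Algebra ℂ B]

/-- The grading of `B ⊗ osp_q(1|2)` by the degree of the last factor, as a coaction of `ℤ`. -/
def grading : B ⊗[ℂ] Osp Q →ₐ[ℂ] AddMonoidAlgebra (B ⊗[ℂ] Osp Q) ℤ :=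
  Algebra.TensorProduct.lift
    (AddMonoidAlgebra.singleZeroAlgHom.comp Algebra.TensorProduct.includeLeft)
    (Osp.lift _ ((Osp.isOsp_gen Q).map (Algebra.TensorProduct.includeRight (A := B))).single)
    (fun b u => by
      refine Osp.commute_of_gen Q _ _ (fun i => ?_) u
      rw [Osp.lift_gen]
      simp [-LaurentPolynomial.single_eq_C_mul_T, Commute, SemiconjBy, AddMonoidAlgebra.single_mul_single])

theorem grading_tmul_gen (b : B) (i : OspGen) :
    grading Q B (b ⊗ₜ Osp.gen Q i)
      = AddMonoidAlgebra.single (OspGen.degree i) (b ⊗ₜ Osp.gen Q i) := by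
  rw [grading, Algebra.TensorProduct.lift_tmul, Osp.lift_gen]
  simp [-LaurentPolynomial.single_eq_C_mul_T, AddMonoidAlgebra.single_mul_single]

/-- Forgetting the degree. -/
def forgetDegree (M : Type) [Ring M] [Algebra ℂ M] : AddMonoidAlgebra M ℤ →ₐ[ℂ] M :=
  AddMonoidAlgebra.liftNCAlgHom (AlgHom.id ℂ M) 1 (fun _ _ => Commute.one_right _)

theorem forgetDegree_single (M : Type) [Ring M] [Algebra ℂ M] (i : ℤ) (m : M) :
    forgetDegree M (AddMonoidAlgebra.single i m) = m := by
  simp [-LaurentPolynomial.single_eq_C_mul_T, forgetDegree]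

/-- An element is the sum of its homogeneous components; in particular it vanishes as soon as all of
them do. -/
theorem forgetDegree_grading (z : B ⊗[ℂ] Osp Q) :
    forgetDegree (B ⊗[ℂ] Osp Q) (grading Q B z) = z := by
  have : (forgetDegree (B ⊗[ℂ] Osp Q)).comp (grading Q B) = AlgHom.id ℂ _ := by
    refine Algebra.TensorProduct.ext ?_ (Osp.hom_ext fun i => ?_)
    · ext b
      simp [-LaurentPolynomial.single_eq_C_mul_T, grading, forgetDegree_single]
    · simp [-LaurentPolynomial.single_eq_C_mul_T, grading_tmul_gen, forgetDegree_single]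
  exact DFunLike.congr_fun this z

/-- An element of nonzero degree in the last factor fixes no nonzero element. -/
theorem eq_zero_of_degree_neg_one {m z : B ⊗[ℂ] Osp Q}
    (hm : grading Q B m = AddMonoidAlgebra.single (-1) m) (hz : m * z = z) : z = 0 := by
  -- Multiplication by m lowers the degree by one, so comparing components in z = m z expresses each
  -- component through the next higher one.
  have h1 : ∀ i, (grading Q B z).coeff i = m * (grading Q B z).coeff (i + 1) := by
    intro i
    conv_lhs => rw [← hz, map_mul, hm, show i = -1 + (i + 1) by ring]
    simp [-LaurentPolynomial.single_eq_C_mul_T, add_comm]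
  have h2 : ∀ (n : ℕ) (i : ℤ), (grading Q B z).coeff i = m ^ n * (grading Q B z).coeff (i + n) := by
    intro n
    induction n with
    | zero => simp
    | succ n ih =>
      intro i
      rw [ih, h1 (i + n), ← mul_assoc, ← pow_succ]
      push_cast
      rw [add_assoc]
  have h3 : grading Q B z = 0 := by
    ext i
    obtain ⟨N, hN⟩ := (grading Q B z).coeff.support.bddAbove
    -- The exponent carries the degree above the upper bound N of the support. If N - i + 1 is
    -- negative it truncates to 0, but then i itself already exceeds N.
    rw [h2 (N - i + 1).toNat, AddMonoidAlgebra.coeff_zero]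
    have : (grading Q B z).coeff (i + (N - i + 1).toNat) = 0 := by
      by_contra hne
      have := hN (Finset.mem_coe.2 (Finsupp.mem_support_iff.2 hne))
      omega
    rw [this, mul_zero]; rfl
  rw [← forgetDegree_grading Q B z, h3, map_zero]

end Grading

/-! ### Transport of commutation relations by rescaling. -/

section Twist

variable {Q} {B : Type} [Ring B] [Algebra ℂ B]

/-- The map `B ⊗ Coid → B ⊗ osp_q(1|2)`. -/
def Coid.inclB (B : Type) [Ring B] [Algebra ℂ B] : B ⊗[ℂ] Coid Q →ₐ[ℂ] B ⊗[ℂ] Osp Q :=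
  Algebra.TensorProduct.map (AlgHom.id ℂ B) (Coid Q).val

theorem Coid.inclB_injective : Function.Injective (Coid.inclB (Q := Q) B) :=
  Module.Flat.lTensor_preserves_injective_linearMap (M := B) (Coid Q).val.toLinearMap
    Subtype.val_injective

/-- Intertwining relations extend from `Coid` to `B ⊗ Coid`. -/
theorem tmul_intertwine {E : Type} [Ring E] [Algebra ℂ E] (A : B →ₗ[ℂ] B)
    (θ : Coid Q →ₐ[ℂ] Coid Q) (f : Coid Q →ₐ[ℂ] E) {d : B} {w : E}
    (hA : ∀ b, d * b = A b * d) (hθ : ∀ y, w * f y = f (θ y) * w) (X : B ⊗[ℂ] Coid Q) :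
    (d ⊗ₜ w) * Algebra.TensorProduct.map (AlgHom.id ℂ B) f X
      = Algebra.TensorProduct.map (AlgHom.id ℂ B) f (TensorProduct.map A θ.toLinearMap X)
        * (d ⊗ₜ w) := by
  induction X using TensorProduct.induction_on with
  | zero => simp
  | tmul b y => simp [hA, hθ]
  | add x y hx hy => simp only [map_add, mul_add, add_mul, hx, hy]

/-- If `X ∈ B ⊗ Coid` commutes with `d ⊗ h`, and `w` intertwines the values of `f` in the same way
as `h` intertwines `Coid`, then `(1 ⊗ f) X` commutes with `d ⊗ w`. -/
theorem commute_of_twist {E : Type} [Ring E] [Algebra ℂ E] (f : Coid Q →ₐ[ℂ] E)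
    {χ : CoidGen → ℂ} (hab : χ .a * χ .b = 1) (hc : χ .c = 1) (hg : χ .g = 1)
    {h : Osp Q} {w : E} {d : B} (hu : IsUnit h) (du : IsUnit d)
    (hh : ∀ j, h * Osp.coidGen Q j = χ j • (Osp.coidGen Q j * h))
    (hw : ∀ j, w * f (Coid.gen Q j) = χ j • (f (Coid.gen Q j) * w))
    {X : B ⊗[ℂ] Coid Q} (hX : Commute (d ⊗ₜ h) (Coid.inclB B X)) :
    Commute (d ⊗ₜ w) (Algebra.TensorProduct.map (AlgHom.id ℂ B) f X) := by
  let θ : Coid Q →ₐ[ℂ] Coid Q := Coid.lift _ ((Coid.isCoid_gen Q).rescale hab hc hg)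
  have hθ : ∀ j, θ (Coid.gen Q j) = χ j • Coid.gen Q j := fun j => Coid.lift_gen _ _ j
  obtain ⟨d, rfl⟩ := du
  obtain ⟨h, rfl⟩ := hu
  -- Conjugation by d, the counterpart on B of the rescaling θ, which is conjugation by h on `Coid`.
  let A : B →ₗ[ℂ] B := LinearMap.mulLeft ℂ (d : B) ∘ₗ LinearMap.mulRight ℂ ((d⁻¹ : Bˣ) : B)
  have hA : ∀ b, (d : B) * b = A b * d := fun b => by simp [A, mul_assoc]
  have h1 := tmul_intertwine A θ (Coid Q).val (w := (h : Osp Q)) hA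
    (fun y => Coid.intertwine (f := (Coid Q).val) (g := (Coid Q).val.comp θ) (fun j => by
      simpa [hθ] using! hh j) y) X
  have h2 := tmul_intertwine A θ f (w := w) hA
    (fun y => Coid.intertwine (f := f) (g := f.comp θ) (fun j => by
      simpa [hθ] using hw j) y) X
  -- Commuting with the unit d ⊗ h means being fixed by conjugation with it. Only d and h have to be
  -- invertible here; w may be any element with the same scalars.
  have h3 : TensorProduct.map A θ.toLinearMap X = X := by
    apply Coid.inclB_injective
    have hinv : ((d : B) ⊗ₜ (h : Osp Q)) * (((d⁻¹ : Bˣ) : B) ⊗ₜ[ℂ] ((h⁻¹ : (Osp Q)ˣ) : Osp Q))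
       = 1 := by simp [Algebra.TensorProduct.one_def]
    have h4 := congrArg (· * (((d⁻¹ : Bˣ) : B) ⊗ₜ[ℂ] ((h⁻¹ : (Osp Q)ˣ) : Osp Q)))
      (h1.symm.trans hX.eq)
    simpa only [mul_assoc, hinv, mul_one] using! h4
  rw [h3] at h2
  exact h2

end Twist

/-! ### Commutation scalars of K, P and K²P, and centrality of the Casimir element. -/

/-- The scalars by which `K` commutes with the generators of `Coid`. -/
def Coid.weightK : CoidGen → ℂ
  | .a => (Q.s)⁻¹
  | .b => Q.s
  | _ => 1

/-- The scalars by which `P` commutes with the generators of `Coid`. -/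
def Coid.weightP : CoidGen → ℂ
  | .a => -1
  | .b => -1
  | _ => 1

/-- The values of τ are homogeneous for the diagonal weights: conjugation by K ⊗ K or P ⊗ P rescales
τ(x) just as conjugation by K or P rescales the generator x. These are the hypotheses of
`commute_of_twist` for K and P. -/
theorem Coid.grouplike_mul :
    (∀ j, Osp.k Q * Osp.coidGen Q j = Coid.weightK Q j • (Osp.coidGen Q j * Osp.k Q)) ∧
    (∀ j, Osp.p Q * Osp.coidGen Q j = Coid.weightP j • (Osp.coidGen Q j * Osp.p Q)) ∧
    (∀ j, (Osp.k Q ⊗ₜ Osp.k Q) * Coid.coactOsp Q (Coid.gen Q j)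
      = Coid.weightK Q j • (Coid.coactOsp Q (Coid.gen Q j) * (Osp.k Q ⊗ₜ Osp.k Q))) ∧
    (∀ j, (Osp.p Q ⊗ₜ Osp.p Q) * Coid.coactOsp Q (Coid.gen Q j)
      = Coid.weightP j • (Coid.coactOsp Q (Coid.gen Q j) * (Osp.p Q ⊗ₜ Osp.p Q))) := by
  have hs := Q.s_ne_zero
  have hs2 := Q.s_two
  have hs4 := Q.s_four
  obtain ⟨h1, h2, h3, h4, h5, h6, h7, h8, h9, h10, h11, h12⟩ := (Osp.isOsp_gen Q).nf
  have a1 := Osp.assoc_rule h1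
  have a2 := Osp.assoc_rule h2
  have a3 := Osp.assoc_rule h3
  have a4 := Osp.assoc_rule h4
  have a5 := Osp.assoc_rule h5
  have a6 := Osp.assoc_rule h6
  have a7 := Osp.assoc_rule h7
  have a8 := Osp.assoc_rule h8
  have a9 := Osp.assoc_rule h9
  have a10 := Osp.assoc_rule h10
  have a11 := Osp.assoc_rule h11
  have a12 := Osp.assoc_rule h12
  have hg : ∀ j, ((Coid.gen Q j : Coid Q) : Osp Q) = Osp.coidGen Q j := fun _ => rfl
  refine ⟨?_, ?_, ?_, ?_⟩ <;> intro j <;> cases j <;>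
  · simp only [weightK, weightP, coactOsp, AlgHom.comp_apply, Coid.coact_gen, coactGen, map_add,
      map_sub, map_smul, incl_tmul, hg, Osp.coidGen, Osp.casimir, Osp.ap, Osp.am, Osp.k,
      Osp.ki, Osp.p, pow_two (Osp.gen _ _), Q.pow_neg_half, Q.pow_half, Q.q_eq,
      mul_add, add_mul, sub_mul, mul_sub, smul_sub, smul_add, neg_mul, mul_neg,
      Algebra.TensorProduct.tmul_mul_tmul, mul_assoc, smul_mul_assoc, mul_smul_comm,
      TensorProduct.tmul_smul, ← TensorProduct.smul_tmul', smul_smul, TensorProduct.tmul_add,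
      TensorProduct.add_tmul, TensorProduct.sub_tmul, TensorProduct.tmul_sub,
      TensorProduct.neg_tmul, TensorProduct.tmul_neg,
      h1, h2, h3, h4, h5, h6, h7, h8, h9, h10, h11, h12,
      a1, a2, a3, a4, a5, a6, a7, a8, a9, a10, a11, a12, one_mul, mul_one]
    try (match_scalars <;> field_simp <;> ring)

/-- The factor of Γ^q in front of P anticommutes with A±, as P does, and it commutes with K and P;
the signs cancel in the product. -/
theorem Coid.casimir_commute (u : Osp Q) : Commute (Osp.casimir Q) u := by
  refine Osp.commute_of_gen Q (AlgHom.id ℂ _) _ (fun j => ?_) u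
  have hs := Q.s_ne_zero
  have hs2 := Q.s_two
  have hs4 := Q.s_four
  obtain ⟨h1, h2, h3, h4, h5, h6, h7, h8, h9, h10, h11, h12⟩ := (Osp.isOsp_gen Q).nf
  have a1 := Osp.assoc_rule h1
  have a2 := Osp.assoc_rule h2
  have a3 := Osp.assoc_rule h3
  have a4 := Osp.assoc_rule h4
  have a5 := Osp.assoc_rule h5
  have a6 := Osp.assoc_rule h6
  have a7 := Osp.assoc_rule h7
  have a8 := Osp.assoc_rule h8
  have a9 := Osp.assoc_rule h9
  have a10 := Osp.assoc_rule h10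
  have a11 := Osp.assoc_rule h11
  have a12 := Osp.assoc_rule h12
  cases j <;>
  · simp only [Commute, SemiconjBy, AlgHom.id_apply, Osp.casimir, Osp.ap, Osp.am, Osp.k,
      Osp.ki, Osp.p, pow_two (Osp.gen _ _), Q.pow_neg_half, Q.pow_half, Q.q_eq,
      mul_add, add_mul, sub_mul, mul_sub, smul_sub, smul_add, neg_mul, mul_neg,
      mul_assoc, smul_mul_assoc, mul_smul_comm, smul_smul,
      h1, h2, h3, h4, h5, h6, h7, h8, h9, h10, h11, h12,
      a1, a2, a3, a4, a5, a6, a7, a8, a9, a10, a11, a12, one_mul, mul_one]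
    try (match_scalars <;> field_simp <;> ring)

theorem Osp.isUnit_k : IsUnit (Osp.k Q) :=
  ⟨⟨Osp.k Q, Osp.ki Q, (Osp.isOsp_gen Q).k_ki, (Osp.isOsp_gen Q).ki_k⟩, rfl⟩

theorem Osp.isUnit_p : IsUnit (Osp.p Q) := by
  have h := (Osp.isOsp_gen Q).p_p
  rw [pow_two] at h
  exact ⟨⟨Osp.p Q, Osp.p Q, h, h⟩, rfl⟩

theorem Osp.isUnit_c : IsUnit (Osp.coidGen Q .c) :=
  ((Osp.isUnit_k Q).pow 2).mul (Osp.isUnit_p Q)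

theorem Coid.c_mul (j : CoidGen) :
    Osp.coidGen Q .c * Osp.coidGen Q j
      = Coid.weightC Q j • (Osp.coidGen Q j * Osp.coidGen Q .c) := by
  have h := Osp.isCoid_coidGen Q
  cases j
  · exact h.ca
  · exact h.cb
  · simp [weightC]
  · simp [weightC, h.gc]

/-- Since K²P is grouplike, its square tensor is a product of K ⊗ K, K ⊗ K and P ⊗ P, and the
scalars multiply. -/
theorem Coid.cc_mul (j : CoidGen) :
    (Osp.coidGen Q .c ⊗ₜ Osp.coidGen Q .c) * Coid.coactOsp Q (Coid.gen Q j)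
      = Coid.weightC Q j •
        (Coid.coactOsp Q (Coid.gen Q j) * (Osp.coidGen Q .c ⊗ₜ Osp.coidGen Q .c)) := by
  obtain ⟨-, -, h3, h4⟩ := Coid.grouplike_mul Q
  have : (Osp.coidGen Q .c ⊗ₜ[ℂ] Osp.coidGen Q .c)
      = (Osp.k Q ⊗ₜ[ℂ] Osp.k Q) * ((Osp.k Q ⊗ₜ Osp.k Q) * (Osp.p Q ⊗ₜ Osp.p Q)) := by
    simp [Osp.coidGen, pow_two, mul_assoc]
  rw [this, mul_assoc, mul_assoc, h4, mul_smul_comm, ← mul_assoc (Osp.k Q ⊗ₜ[ℂ] Osp.k Q), h3,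
    smul_mul_assoc, mul_smul_comm, mul_smul_comm, mul_assoc, ← mul_assoc (Osp.k Q ⊗ₜ[ℂ] Osp.k Q), h3]
  simp only [smul_mul_assoc, smul_smul, mul_assoc]
  congr 1
  cases j <;> simp [weightC, weightK, weightP, pow_two]

/-! ### The coaction τ preserves commutation with iterated coproducts. -/

section Coact

variable {Q} {B : Type} [Ring B] [Algebra ℂ B] (δ : Osp Q →ₐ[ℂ] B)

/-- The morphism `(δ ⊗ 1) ∘ Δ`. -/
def Osp.diag : Osp Q →ₐ[ℂ] B ⊗[ℂ] Osp Q :=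
  (Algebra.TensorProduct.map δ (AlgHom.id ℂ (Osp Q))).comp (Osp.comul Q)

theorem Osp.comul_coidGen (i : CoidGen) :
    Osp.comul Q (Osp.coidGen Q i) = Coid.incl Q (Coid.comulGen Q i) :=
  (Coid.incl_comulGen Q i).symm

/-- `1 ⊗ τ`. -/
abbrev Coid.coactB (B : Type) [Ring B] [Algebra ℂ B] :
    B ⊗[ℂ] Coid Q →ₐ[ℂ] B ⊗[ℂ] (Osp Q ⊗[ℂ] Osp Q) :=
  Algebra.TensorProduct.map (AlgHom.id ℂ B) (Coid.coactOsp Q)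

/-- `1 ⊗ Δ`. -/
abbrev Osp.comulB (B : Type) [Ring B] [Algebra ℂ B] :
    B ⊗[ℂ] Osp Q →ₐ[ℂ] B ⊗[ℂ] (Osp Q ⊗[ℂ] Osp Q) :=
  Algebra.TensorProduct.map (AlgHom.id ℂ B) (Osp.comul Q)

variable (Q) in
theorem Coid.weightC_mul : Coid.weightC Q .a * Coid.weightC Q .b = 1 := by
  have := Q.s_ne_zero
  simp [weightC, this]

variable (Q) in
theorem Coid.weightK_mul : Coid.weightK Q .a * Coid.weightK Q .b = 1 := by
  have := Q.s_ne_zero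
  simp [weightK, this]

variable {δ}

variable (Q) in
/-- `τ(K²P)` and its multiples act injectively from the left. -/
theorem Coid.coactOsp_c_regular {d : B} (hd : IsUnit d) {z : B ⊗[ℂ] (Osp Q ⊗[ℂ] Osp Q)}
    (h : (d ⊗ₜ Coid.coactOsp Q (Coid.gen Q .c)) * z = 0) : z = 0 := by
  obtain ⟨d, rfl⟩ := hd
  -- The inverse of K²P. Multiplying τ(K²P) by it in the last factor turns the leading term into 1.
  let c' : Osp Q := Osp.p Q * (Osp.ki Q * Osp.ki Q)
  have hc : c' * Osp.coidGen Q .c = 1 := by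
    obtain ⟨-, -, -, -, -, -, -, -, -, h1, h2, -⟩ := (Osp.isOsp_gen Q).nf
    simp only [c', Osp.coidGen, pow_two, mul_assoc, Osp.assoc_rule h1, one_mul, h2]
  let e := (Algebra.TensorProduct.assoc ℂ ℂ ℂ B (Osp Q) (Osp Q)).symm
  apply e.injective
  rw [map_zero]
  let l : ℂ := Q.q - Q.q⁻¹
  -- With this m the hypothesis reads (1 - m) z = 0. Its last factor contains one A₋ and otherwise
  -- only K and P, hence the degree -1.
  let m : (B ⊗[ℂ] Osp Q) ⊗[ℂ] Osp Q := l • ((1 ⊗ₜ Osp.coidGen Q .b) ⊗ₜ (c' * Osp.coidGen Q .a))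
  have hτ : Coid.coactOsp Q (Coid.gen Q .c)
      = 1 ⊗ₜ Osp.coidGen Q .c - l • (Osp.coidGen Q .b ⊗ₜ Osp.coidGen Q .a) := by
    rw [coactOsp, AlgHom.comp_apply, coact_gen]
    simp [coactGen, incl_tmul, gen, Osp.coidGen, l]
  refine eq_zero_of_degree_neg_one Q (B ⊗[ℂ] Osp Q) (m := m) ?_ ?_
  · have : ((1 : B) ⊗ₜ[ℂ] Osp.coidGen Q .b) ⊗ₜ[ℂ] (c' * Osp.coidGen Q .a)
        = (1 ⊗ₜ Osp.p Q) * ((1 ⊗ₜ Osp.ki Q) * (1 ⊗ₜ Osp.ki Q)) * ((1 ⊗ₜ Osp.am Q) *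
          ((1 ⊗ₜ[ℂ] Osp.coidGen Q .b) ⊗ₜ Osp.k Q)) := by
      simp [c', Osp.coidGen]
    simp only [m, this, map_smul, map_mul, grading_tmul_gen, AddMonoidAlgebra.single_mul_single,
      AddMonoidAlgebra.smul_single, OspGen.degree, Osp.am, Osp.p, Osp.ki, Osp.k]
    norm_num
  · have h1 := congrArg (fun y => e (((d⁻¹ : Bˣ) : B) ⊗ₜ (1 ⊗ₜ c') * y)) h
    simp only [mul_zero, map_zero, ← mul_assoc] at h1
    rw [hτ] at h1
    simp only [Algebra.TensorProduct.tmul_mul_tmul, mul_sub, mul_smul_comm, Units.inv_mul, one_mul,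
      ← Algebra.TensorProduct.one_def, TensorProduct.tmul_sub, TensorProduct.tmul_smul, sub_mul,
      map_sub, map_mul, map_smul, hc] at h1
    exact (sub_eq_zero.1 h1).symm

variable (δ) in
/-- The values of `(δ ⊗ 1) ∘ Δ` on the generators of `Coid`, as elements of `B ⊗ Coid`. -/
def Coid.diagGen (i : CoidGen) : B ⊗[ℂ] Coid Q :=
  Algebra.TensorProduct.map δ (AlgHom.id ℂ (Coid Q)) (Coid.comulGen Q i)

variable (δ) in
theorem Coid.inclB_diagGen (i : CoidGen) :
    Coid.inclB B (Coid.diagGen δ i) = Osp.diag δ (Osp.coidGen Q i) := by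
  rw [Osp.diag, AlgHom.comp_apply, Osp.comul_coidGen, diagGen]
  generalize Coid.comulGen Q i = z
  induction z using TensorProduct.induction_on with
  | zero => simp
  | tmul x y => simp [inclB, incl]
  | add x y hx hy => simp only [map_add, hx, hy]

/-- The coaction `τ` preserves the property of commuting with the images of iterated coproducts. -/
theorem Coid.commute_coact {X : B ⊗[ℂ] Coid Q}
    (hX : ∀ u, Commute (Osp.diag δ u) (Coid.inclB B X)) (u : Osp Q) :
    Commute (Osp.comulB B (Osp.diag δ u)) (Coid.coactB B X) := by
  obtain ⟨k1, p1, k2, p2⟩ := Coid.grouplike_mul Q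
  have dk : Osp.diag δ (Osp.k Q) = δ (Osp.k Q) ⊗ₜ Osp.k Q := by
    simp [Osp.diag, Osp.comul_gen, Osp.comulGen]
  have dp : Osp.diag δ (Osp.p Q) = δ (Osp.p Q) ⊗ₜ Osp.p Q := by
    simp [Osp.diag, Osp.comul_gen, Osp.comulGen]
  have dc : Osp.diag δ (Osp.coidGen Q .c) = δ (Osp.coidGen Q .c) ⊗ₜ Osp.coidGen Q .c := by
    simp [Osp.coidGen, dk, dp, Algebra.TensorProduct.tmul_pow]
  have cc : Osp.comul Q (Osp.coidGen Q .c) = Osp.coidGen Q .c ⊗ₜ Osp.coidGen Q .c := by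
    rw [Osp.comul_coidGen]; rfl
  have hk : Commute (Osp.comulB B (Osp.diag δ (Osp.k Q))) (Coid.coactB B X) := by
    have := commute_of_twist (Coid.coactOsp Q) (Coid.weightK_mul Q) rfl rfl (Osp.isUnit_k Q)
      ((Osp.isUnit_k Q).map δ) k1 k2 (dk ▸ hX (Osp.k Q))
    simpa [dk, Osp.comul_gen, Osp.comulGen] using this
  have hp : Commute (Osp.comulB B (Osp.diag δ (Osp.p Q))) (Coid.coactB B X) := by
    have := commute_of_twist (χ := Coid.weightP) (Coid.coactOsp Q) (by simp [Coid.weightP]) rfl rfl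
      (Osp.isUnit_p Q) ((Osp.isUnit_p Q).map δ) p1 p2 (dp ▸ hX (Osp.p Q))
    simpa [dp, Osp.comul_gen, Osp.comulGen] using this
  have hki : Commute (Osp.comulB B (Osp.diag δ (Osp.ki Q))) (Coid.coactB B X) := by
    let w : (B ⊗[ℂ] (Osp Q ⊗[ℂ] Osp Q))ˣ := ⟨Osp.comulB B (Osp.diag δ (Osp.k Q)),
      Osp.comulB B (Osp.diag δ (Osp.ki Q)),
      by rw [← map_mul, ← map_mul, (Osp.isOsp_gen Q).k_ki, map_one, map_one],
      by rw [← map_mul, ← map_mul, (Osp.isOsp_gen Q).ki_k, map_one, map_one]⟩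
    exact Commute.units_inv_left (u := w) hk
  -- The coproducts of the generators of `Coid` have last factor in `Coid`, so they commute with X
  -- already in B ⊗ Coid, and the morphism 1 ⊗ τ carries this relation over.
  have hD : ∀ i, Commute (Coid.coactB B (Coid.diagGen δ i)) (Coid.coactB B X) := by
    intro i
    refine Commute.map ?_ (Coid.coactB B)
    apply Coid.inclB_injective
    rw [map_mul, map_mul, Coid.inclB_diagGen]
    exact hX _
  have hc := (Osp.isUnit_c Q).map δ
  -- The twisting argument with d = δ(K²P) and h = K²P. It is applied below both to K²P ⊗ K²P and to
  -- the obstruction.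
  have hC : ∀ w : Osp Q ⊗[ℂ] Osp Q, (∀ j, w * Coid.coactOsp Q (Coid.gen Q j)
      = Coid.weightC Q j • (Coid.coactOsp Q (Coid.gen Q j) * w)) →
      Commute (δ (Osp.coidGen Q .c) ⊗ₜ w) (Coid.coactB B X) := fun w hw =>
    commute_of_twist (Coid.coactOsp Q) (Coid.weightC_mul Q) rfl rfl (Osp.isUnit_c Q) hc
      (Coid.c_mul Q) hw (dc ▸ hX (Osp.coidGen Q .c))
  have hτc : Coid.coactOsp Q (Coid.gen Q .c) * (Osp.coidGen Q .c ⊗ₜ Osp.coidGen Q .c)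
      = (Osp.coidGen Q .c ⊗ₜ Osp.coidGen Q .c) * Coid.coactOsp Q (Coid.gen Q .c) := by
    rw [Coid.cc_mul]
    exact (one_smul ℂ _).symm
  -- This treats A₋K and A₊K together; only the shape of their coproduct and the commutation of the
  -- obstruction enter.
  have key : ∀ i, Coid.comulGen Q i = Osp.coidGen Q i ⊗ₜ Coid.gen Q .c + 1 ⊗ₜ Coid.gen Q i →
      (∀ j, Coid.obstruction Q i * Coid.coactGen Q j
        = Coid.weightC Q j • (Coid.coactGen Q j * Coid.obstruction Q i)) →
      Commute (Osp.comulB B (Osp.diag δ (Osp.coidGen Q i))) (Coid.coactB B X) := by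
    intro i hi hobs
    have hD' : Coid.diagGen δ i = δ (Osp.coidGen Q i) ⊗ₜ Coid.gen Q .c + 1 ⊗ₜ Coid.gen Q i := by
      rw [Coid.diagGen, hi]; simp
    have hobs' : Coid.incl Q (Coid.obstruction Q i)
        = Coid.coactOsp Q (Coid.gen Q .c) * Osp.comul Q (Osp.coidGen Q i)
          - (Osp.coidGen Q .c ⊗ₜ Osp.coidGen Q .c) * Coid.coactOsp Q (Coid.gen Q i) := by
      rw [Coid.obstruction, map_sub, map_mul, map_mul, Coid.incl_comulGen, Coid.coactOsp,
        AlgHom.comp_apply, AlgHom.comp_apply, Coid.coact_gen, Coid.coact_gen, Coid.incl_tmul]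
      rfl
    set T := Osp.comulB B (Osp.diag δ (Osp.coidGen Q i)) with hT
    have hT' : T = δ (Osp.coidGen Q i) ⊗ₜ (Osp.coidGen Q .c ⊗ₜ Osp.coidGen Q .c)
        + 1 ⊗ₜ Osp.comul Q (Osp.coidGen Q i) := by
      rw [hT, ← Coid.inclB_diagGen, hD', map_add, map_add, ← cc]
      rfl
    have hτ' : Coid.coactB B (Coid.diagGen δ i)
        = δ (Osp.coidGen Q i) ⊗ₜ Coid.coactOsp Q (Coid.gen Q .c)
          + 1 ⊗ₜ Coid.coactOsp Q (Coid.gen Q i) := by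
      rw [hD', map_add]; simp
    have he : Commute (δ (Osp.coidGen Q .c) ⊗ₜ[ℂ] Coid.coactOsp Q (Coid.gen Q .c))
        (Coid.coactB B X) := by
      have := hD .c
      simpa [Coid.diagGen, Coid.comulGen, Osp.coidGen] using this
    -- The left factor is chosen so that the terms containing δ of the generator agree on both
    -- sides, as τ(K²P) commutes with K²P ⊗ K²P; what remains is the obstruction.
    have hS : (δ (Osp.coidGen Q .c) ⊗ₜ[ℂ] Coid.coactOsp Q (Coid.gen Q .c)) * T
        = (δ (Osp.coidGen Q .c) ⊗ₜ (Osp.coidGen Q .c ⊗ₜ Osp.coidGen Q .c))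
            * Coid.coactB B (Coid.diagGen δ i)
          + δ (Osp.coidGen Q .c) ⊗ₜ Coid.incl Q (Coid.obstruction Q i) := by
      rw [hT', hτ', hobs', mul_add, mul_add, Algebra.TensorProduct.tmul_mul_tmul,
        Algebra.TensorProduct.tmul_mul_tmul, Algebra.TensorProduct.tmul_mul_tmul,
        Algebra.TensorProduct.tmul_mul_tmul, hτc, mul_one, TensorProduct.tmul_sub]
      abel
    have hS' : Commute ((δ (Osp.coidGen Q .c) ⊗ₜ[ℂ] Coid.coactOsp Q (Coid.gen Q .c)) * T)
        (Coid.coactB B X) := by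
      rw [hS]
      refine ((hC _ (Coid.cc_mul Q)).mul_left (hD i)).add_left (hC _ fun j => ?_)
      rw [Coid.coactOsp, AlgHom.comp_apply, Coid.coact_gen, ← map_mul, ← map_mul, hobs j, map_smul]
    -- Both δ(K²P) ⊗ τ(K²P) and its product with T commute with (1 ⊗ τ)X, so this factor annihilates
    -- the commutator of T with (1 ⊗ τ)X and can be cancelled.
    refine sub_eq_zero.1 (Coid.coactOsp_c_regular Q hc ?_)
    rw [mul_sub, ← mul_assoc, hS'.eq, ← mul_assoc, ← mul_assoc, he.eq, sub_self]
  have ha := key .a rfl (Coid.obstruction_a_mul Q)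
  have hb := key .b rfl (Coid.obstruction_b_mul Q)
  -- A₊ and A₋ themselves are recovered from A₊K and A₋K by multiplying with K⁻¹.
  have hcancel : ∀ y : Osp Q, y = y * Osp.k Q * Osp.ki Q := fun y => by
    rw [mul_assoc, (Osp.isOsp_gen Q).k_ki, mul_one]
  refine (Osp.commute_of_gen Q ((Osp.comulB B).comp (Osp.diag δ)) _ (fun y => ?_) u).symm
  rw [AlgHom.comp_apply]
  cases y with
  | ap =>
    rw [hcancel (Osp.gen Q .ap), map_mul, map_mul]
    exact (hb.mul_left hki).symm
  | am =>
    rw [hcancel (Osp.gen Q .am), map_mul, map_mul]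
    exact (ha.mul_left hki).symm
  | k => exact hk.symm
  | ki => exact hki.symm
  | p => exact hp.symm

end Coact

/-! ### Counit, iterated coproducts and coassociativity. -/

/-- The values of the counit on the generators. -/
def Osp.counitGen : OspGen → ℂ
  | .ap => 0
  | .am => 0
  | _ => 1

/-- The counit of `osp_q(1|2)`. -/
def Osp.counit : Osp Q →ₐ[ℂ] ℂ :=
  Osp.lift Osp.counitGen (by constructor <;> simp [counitGen])

/-- The iterated coproducts `osp_q(1|2) → osp_q(1|2)^{⊗ k}`. -/
def TP.comul : (k : ℕ) → Osp Q →ₐ[ℂ] TP Q k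
  | 0 => (TP.zeroEquiv Q).symm.toAlgHom.comp (Osp.counit Q)
  | k + 1 => (TP.succEquiv Q k).symm.toAlgHom.comp (Osp.diag (TP.comul k))

variable {Q} in
/-- Coassociativity. -/
theorem Osp.diag_diag {B : Type} [Ring B] [Algebra ℂ B] (δ : Osp Q →ₐ[ℂ] B) (u : Osp Q) :
    (Algebra.TensorProduct.assoc ℂ ℂ ℂ B (Osp Q) (Osp Q)).symm (Osp.comulB B (Osp.diag δ u))
      = Osp.diag (Osp.diag δ) u := by
  have : ((Algebra.TensorProduct.assoc ℂ ℂ ℂ B (Osp Q) (Osp Q)).symm.toAlgHom.comp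
      ((Osp.comulB B).comp (Osp.diag δ))) = Osp.diag (Osp.diag δ) := by
    refine Osp.hom_ext fun i => ?_
    cases i <;> simp [Osp.diag, Osp.comul_gen, Osp.comulGen, TensorProduct.tmul_add,
      TensorProduct.add_tmul, add_assoc]
  exact DFunLike.congr_fun this u

/-! ### Invariance of the states of the extension procedure. -/

/-- The property of `X ∈ osp_q(1|2)^{⊗ k} ⊗ Coid` to commute with the images of the iterated
coproduct. -/
def Coid.Invariant {k : ℕ} (X : TP Q k ⊗[ℂ] Coid Q) : Prop :=
  ∀ u, Commute (Osp.diag (TP.comul Q k) u) (Coid.inclB (TP Q k) X)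

variable {Q}

theorem Osp.map_diag {B C : Type} [Ring B] [Algebra ℂ B] [Ring C] [Algebra ℂ C]
    (δ : Osp Q →ₐ[ℂ] B) (f : B →ₐ[ℂ] C) (u : Osp Q) :
    Algebra.TensorProduct.map f (AlgHom.id ℂ (Osp Q)) (Osp.diag δ u) = Osp.diag (f.comp δ) u := by
  have : (Algebra.TensorProduct.map f (AlgHom.id ℂ (Osp Q))).comp (Osp.diag δ)
      = Osp.diag (f.comp δ) := by
    rw [Osp.diag, Osp.diag, ← AlgHom.comp_assoc, ← Algebra.TensorProduct.map_comp, AlgHom.id_comp]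
  exact DFunLike.congr_fun this u

theorem Coid.inclB_map {B C : Type} [Ring B] [Algebra ℂ B] [Ring C] [Algebra ℂ C]
    (f : B →ₐ[ℂ] C) (X : B ⊗[ℂ] Coid Q) :
    Coid.inclB C (Algebra.TensorProduct.map f (AlgHom.id ℂ (Coid Q)) X)
      = Algebra.TensorProduct.map f (AlgHom.id ℂ (Osp Q)) (Coid.inclB B X) := by
  induction X using TensorProduct.induction_on with
  | zero => simp
  | tmul x y => simp [inclB]
  | add x y hx hy => simp only [map_add, hx, hy]

theorem Coid.inclB_assoc_symm {B : Type} [Ring B] [Algebra ℂ B] (f : Coid Q →ₐ[ℂ] Osp Q ⊗[ℂ] Coid Q)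
    (X : B ⊗[ℂ] Coid Q) :
    Coid.inclB (B ⊗[ℂ] Osp Q) ((Algebra.TensorProduct.assoc ℂ ℂ ℂ B (Osp Q) (Coid Q)).symm
      (Algebra.TensorProduct.map (AlgHom.id ℂ B) f X))
    = (Algebra.TensorProduct.assoc ℂ ℂ ℂ B (Osp Q) (Osp Q)).symm
      (Algebra.TensorProduct.map (AlgHom.id ℂ B) ((Coid.incl Q).comp f) X) := by
  induction X using TensorProduct.induction_on with
  | zero => simp
  | tmul x y =>
    simp only [Algebra.TensorProduct.map_tmul, AlgHom.comp_apply]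
    induction f y using TensorProduct.induction_on with
    | zero => simp
    | tmul z w => simp [inclB, incl]
    | add z w hz hw => simp only [map_add, TensorProduct.tmul_add, hz, hw]
  | add x y hx hy => simp only [map_add, hx, hy]

/-- By coassociativity the next iterated coproduct is 1 ⊗ Δ applied to the present one, so the
bracketing and the inclusion of `Coid` can be dealt with once for both Δ and τ. What is left is a
condition in B ⊗ (osp ⊗ osp). -/
theorem Coid.Invariant.extLast {k : ℕ} {X : TP Q k ⊗[ℂ] Coid Q}
    (f : Coid Q →ₐ[ℂ] Osp Q ⊗[ℂ] Coid Q)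
    (hf : ∀ u, Commute (Osp.comulB (TP Q k) (Osp.diag (TP.comul Q k) u))
      (Algebra.TensorProduct.map (AlgHom.id ℂ (TP Q k)) ((Coid.incl Q).comp f) X)) :
    Coid.Invariant Q (QDunkl.extLast Q f k X) := by
  intro u
  have h := ((hf u).map (Algebra.TensorProduct.assoc ℂ ℂ ℂ (TP Q k) (Osp Q) (Osp Q)).symm).map
    (Algebra.TensorProduct.map (TP.succEquiv Q k).symm.toAlgHom (AlgHom.id ℂ (Osp Q)))
  rw [Osp.diag_diag, Osp.map_diag, ← Coid.inclB_assoc_symm, ← Coid.inclB_map] at h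
  exact h

theorem Coid.Invariant.extLast_comul {k : ℕ} {X : TP Q k ⊗[ℂ] Coid Q} (hX : Coid.Invariant Q X) :
    Coid.Invariant Q (QDunkl.extLast Q (Coid.comul Q) k X) := by
  refine Coid.Invariant.extLast _ fun u => ?_
  have h := (hX u).map (Osp.comulB (TP Q k))
  have e : (Coid.incl Q).comp (Coid.comul Q) = (Osp.comul Q).comp (Coid Q).val :=
    AlgHom.ext fun y => Coid.incl_comul Q y
  have : Algebra.TensorProduct.map (AlgHom.id ℂ (TP Q k)) ((Coid.incl Q).comp (Coid.comul Q)) X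
      = Osp.comulB (TP Q k) (Coid.inclB (TP Q k) X) := by
    rw [e]
    exact DFunLike.congr_fun (Algebra.TensorProduct.map_comp (AlgHom.id ℂ (TP Q k))
      (AlgHom.id ℂ (TP Q k)) (Osp.comul Q) (Coid Q).val) X
  rw [this]
  exact h

theorem Coid.Invariant.extLast_coact {k : ℕ} {X : TP Q k ⊗[ℂ] Coid Q} (hX : Coid.Invariant Q X) :
    Coid.Invariant Q (QDunkl.extLast Q (Coid.coact Q) k X) :=
  Coid.Invariant.extLast _ fun u => Coid.commute_coact hX u

theorem Coid.Invariant.extMid {k : ℕ} {X : TP Q (k + 1) ⊗[ℂ] Coid Q} (hX : Coid.Invariant Q X) :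
    Coid.Invariant Q (QDunkl.extMid Q k X) := by
  intro u
  let f : TP Q (k + 1) →ₐ[ℂ] TP Q (k + 2) := (TP.succEquiv Q (k + 1)).symm.toAlgHom.comp
    ((Algebra.TensorProduct.map (TP.succEquiv Q k).symm.toAlgHom (AlgHom.id ℂ (Osp Q))).comp
      ((Algebra.TensorProduct.assoc ℂ ℂ ℂ (TP Q k) (Osp Q) (Osp Q)).symm.toAlgHom.comp
        ((Osp.comulB (TP Q k)).comp (TP.succEquiv Q k).toAlgHom)))
  -- Splitting the last factor of an iterated coproduct by Δ gives the next iterated coproduct. The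
  -- factor in `Coid` is untouched, so invariance is transported by f alone.
  have hf : f.comp (TP.comul Q (k + 1)) = TP.comul Q (k + 2) := by
    refine AlgHom.ext fun v => ?_
    have h1 := congrArg (fun (z : (TP Q k ⊗[ℂ] Osp Q) ⊗[ℂ] Osp Q) => (TP.succEquiv Q (k + 1)).symm
      (Algebra.TensorProduct.map (TP.succEquiv Q k).symm.toAlgHom (AlgHom.id ℂ (Osp Q)) z))
      (Osp.diag_diag (TP.comul Q k) v)
    simp only [Osp.map_diag] at h1
    exact h1
  have h := (hX u).map (Algebra.TensorProduct.map f (AlgHom.id ℂ (Osp Q)))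
  rw [Osp.map_diag, hf, ← Coid.inclB_map] at h
  exact h

theorem Coid.Invariant.casimir (k : ℕ) :
    Coid.Invariant Q ((1 : TP Q k) ⊗ₜ[ℂ] Coid.gen Q .g) := by
  intro u
  change Commute _ ((1 : TP Q k) ⊗ₜ[ℂ] Osp.casimir Q)
  induction Osp.diag (TP.comul Q k) u using TensorProduct.induction_on with
  | zero => exact Commute.zero_left _
  | tmul x y =>
    rw [Commute, SemiconjBy, Algebra.TensorProduct.tmul_mul_tmul,
      Algebra.TensorProduct.tmul_mul_tmul, one_mul, mul_one, (Coid.casimir_commute Q y).eq]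
  | add x y hx hy => exact hx.add_left hy

/-- Both components, including those that carry no meaning, arise from the Casimir element or from 0
by operations that preserve invariance. Hence no bookkeeping of open holes is needed. -/
theorem Coid.invariant_extend (A : Finset ℕ) (k : ℕ) :
    Coid.Invariant Q (extend Q A k).1 ∧ Coid.Invariant Q (extend Q A k).2 := by
  induction k with
  | zero =>
    refine ⟨Coid.Invariant.casimir 0, fun u => ?_⟩
    rw [extend, map_zero]
    exact Commute.zero_right _
  | succ k ih =>
    rw [extend]
    constructor
    · dsimp only
      split_ifs
      · exact Coid.Invariant.casimir _
      · exact ih.1.extLast_comul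
      · exact ih.2
    · dsimp only
      split_ifs
      · exact ih.1.extLast_comul.extLast_coact
      · exact ih.2.extMid

/-- The elements `Γ_A^q` commute with the image of the iterated coproduct. -/
theorem commute_gamma (A : Finset ℕ) (n : ℕ) (u : Osp Q) :
    Commute (TP.comul Q n u) (gamma Q A n) := by
  induction n generalizing u with
  | zero => exact Algebra.commute_algebraMap_right _ _
  | succ n ih =>
    rw [gamma]
    split_ifs
    · exact ((Coid.invariant_extend A n).1 u).map (TP.succEquiv Q n).symm
    -- For an appended unit, the next coproduct of u is a sum of tensors whose first component is an
    -- iterated coproduct of some x; the induction hypothesis is needed for all these x, not only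
    -- for u.
    · suffices h : Commute (Osp.diag (TP.comul Q n) u) (gamma Q A n ⊗ₜ[ℂ] (1 : Osp Q)) from
        h.map (TP.succEquiv Q n).symm
      rw [Osp.diag, AlgHom.comp_apply]
      induction Osp.comul Q u using TensorProduct.induction_on with
      | zero => rw [map_zero]; exact Commute.zero_left _
      | tmul x y =>
        rw [Algebra.TensorProduct.map_tmul, Commute, SemiconjBy,
          Algebra.TensorProduct.tmul_mul_tmul, Algebra.TensorProduct.tmul_mul_tmul, one_mul,
          mul_one, (ih x).eq]
      | add x y hx hy => rw [map_add]; exact hx.add_left hy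

/-! ### The Dirac-Dunkl and position operators as iterated coproducts. -/

/-- The iterated coproducts of `K⁻¹` and of `A₊`, `A₋`, realized by the morphisms `ρ`. -/
theorem TP.liftAux_comul {E : Type} [Ring E] [Algebra ℂ E] (k : ℕ) (ρ : Fin k → Osp Q →ₐ[ℂ] E)
    (h : ∀ i j, i ≠ j → ∀ u v, Commute (ρ i u) (ρ j v)) :
    (TP.liftAux k ρ h).1 (TP.comul Q k (Osp.ki Q))
      = ((List.finRange k).map fun j => ρ j (Osp.ki Q)).prod ∧
    ∀ y, Osp.comulGen Q y = Osp.gen Q y ⊗ₜ (Osp.k Q * Osp.p Q) + Osp.ki Q ⊗ₜ Osp.gen Q y →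
      Osp.counitGen y = 0 →
    (TP.liftAux k ρ h).1 (TP.comul Q k (Osp.gen Q y))
      = ∑ i, ρ i (Osp.gen Q y) *
        ((((List.finRange k).filter (· < i)).map fun j => ρ j (Osp.ki Q)).prod *
         (((List.finRange k).filter (i < ·)).map fun j => ρ j (Osp.k Q * Osp.p Q)).prod) := by
  induction k with
  | zero =>
    refine ⟨?_, fun y _ hy => ?_⟩
    · change (Algebra.ofId ℂ E) (Osp.counit Q (Osp.ki Q)) = _
      rw [Osp.counit, Osp.lift_gen]
      simp [Osp.counitGen]
    · change (Algebra.ofId ℂ E) (Osp.counit Q (Osp.gen Q y)) = _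
      rw [Osp.counit, Osp.lift_gen, hy]
      simp
  | succ k ih =>
    let ρ' : Fin k → Osp Q →ₐ[ℂ] E := fun i => ρ i.castSucc
    have h' : ∀ i j, i ≠ j → ∀ u v, Commute (ρ' i u) (ρ' j v) :=
      fun i j hij => h _ _ fun h' => hij (Fin.castSucc_injective k h')
    obtain ⟨ih1, ih2⟩ := ih ρ' h'
    have hr : ∀ t u, Commute ((TP.liftAux k ρ' h').1 t) (ρ (Fin.last k) u) := fun t u =>
      ((TP.liftAux k ρ' h').2 _ (fun i v => h _ _ (Fin.castSucc_lt_last i).ne' u v) t).symm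
    have e : ∀ u, (TP.liftAux (k + 1) ρ h).1 (TP.comul Q (k + 1) u)
        = Algebra.TensorProduct.lift (TP.liftAux k ρ' h').1 (ρ (Fin.last k)) hr
          (Osp.diag (TP.comul Q k) u) := fun u => rfl
    refine ⟨?_, fun y hy hy0 => ?_⟩
    · rw [e, Osp.diag, AlgHom.comp_apply, Osp.comul_gen, Osp.comulGen,
        Algebra.TensorProduct.map_tmul, Algebra.TensorProduct.lift_tmul, ih1,
        List.finRange_succ_last]
      simp [ρ', Function.comp_def]
    · rw [e, Osp.diag, AlgHom.comp_apply, Osp.comul_gen, hy, map_add, map_add,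
        Algebra.TensorProduct.map_tmul, Algebra.TensorProduct.lift_tmul,
        Algebra.TensorProduct.map_tmul, Algebra.TensorProduct.lift_tmul, ih1, ih2 y hy hy0,
        Fin.sum_univ_castSucc, List.finRange_succ_last, Finset.sum_mul]
      congr 1
      · refine Finset.sum_congr rfl fun i _ => ?_
        simp [ρ', List.filter_append, List.filter_map, Function.comp_def, mul_assoc,
          Fin.castSucc_lt_last, (Fin.castSucc_lt_last i).not_gt]
      -- The new summand has the generator in the last position, behind the factors K⁻¹. The formula
      -- wants it in front, and it commutes with them because they act through other tensor factors.
      · have := hr (TP.comul Q k (Osp.ki Q)) (Osp.gen Q y)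
        rw [ih1] at this
        rw [AlgHom.id_apply, this.eq]
        congr 1
        simp [ρ', List.filter_append, List.filter_map, Function.comp_def,
          Fin.castSucc_lt_last, fun i : Fin k => (Fin.castSucc_lt_last i).not_gt]

variable (Q)

theorem model_comul_am {n : ℕ} (μ : Fin n → ℝ) :
    model Q μ (TP.comul Q n (Osp.am Q)) = qDiracDunkl Q μ := by
  rw [model, (TP.liftAux_comul n (modelVar Q μ) _).2 .am rfl rfl]
  simp [qDiracDunkl, modelVar, Osp.lift_gen, modelGen, qR]

theorem model_comul_ap {n : ℕ} (μ : Fin n → ℝ) :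
    model Q μ (TP.comul Q n (Osp.ap Q)) = qPosition Q μ := by
  rw [model, (TP.liftAux_comul n (modelVar Q μ) _).2 .ap rfl rfl]
  simp [qPosition, modelVar, Osp.lift_gen, modelGen, qR]

end QDunkl

end

theorem proposition3p3 (Q : QDunkl.QDeformation) (n : ℕ) (μ : Fin n → ℝ) (hμ : ∀ i, 0 < μ i) :
    (∀ A ⊆ Finset.range n,
      Commute (QDunkl.qDiracDunkl Q μ) (QDunkl.model Q μ (QDunkl.gamma Q A n)) ∧
      Commute (QDunkl.qPosition Q μ) (QDunkl.model Q μ (QDunkl.gamma Q A n))) ∧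
    ∀ a ∈ QDunkl.qBannaiIto Q n,
      Commute (QDunkl.qDiracDunkl Q μ) (QDunkl.model Q μ a) ∧
      Commute (QDunkl.qPosition Q μ) (QDunkl.model Q μ a) := by
  -- The commutant of the iterated coproduct is a subalgebra, so the generators Γ_A suffice.
  have h : ∀ a ∈ QDunkl.qBannaiIto Q n, ∀ u, Commute (QDunkl.TP.comul Q n u) a := by
    intro a ha u
    induction ha using Algebra.adjoin_induction with
    | mem x hx =>
      obtain ⟨A, -, rfl⟩ := hx
      exact QDunkl.commute_gamma A n u
    | algebraMap r => exact Algebra.commute_algebraMap_right _ _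
    | add x y _ _ hx hy => exact hx.add_right hy
    | mul x y _ _ hx hy => exact hx.mul_right hy
  have h' : ∀ a ∈ QDunkl.qBannaiIto Q n,
      Commute (QDunkl.qDiracDunkl Q μ) (QDunkl.model Q μ a) ∧
      Commute (QDunkl.qPosition Q μ) (QDunkl.model Q μ a) := fun a ha => by
    rw [← QDunkl.model_comul_am, ← QDunkl.model_comul_ap]
    exact ⟨(h a ha _).map _, (h a ha _).map _⟩
  exact ⟨fun A hA => h' _ (Algebra.subset_adjoin ⟨A, hA, rfl⟩), h'⟩
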